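/- Let $\{\epsilon_t\}_{t\ge 1}$ be a strictly stationary sequence of real random variables with $E\epsilon_1=0$ and $E|\epsilon_1|^4<\infty$ such that the series $\sum_{t\ge1}\mathrm{Cov}(\epsilon_1^2,\epsilon_{1+t}^2)$ converges, and such that for some constants $0<\eta,\eta'<\infty$, as $T\to\infty$, $$T^{-1/2}\sum_{i\le\lfloor Ts\rfloor}\epsilon_i\Rightarrow\eta B(s),\qquad T^{-1/2}\sum_{i\le\lfloor Ts\rfloor}(\epsilon_i^2-E\epsilon_i^2)\Rightarrow\eta' B^{(2)}(s),$$ where $\Rightarrow$ denotes weak convergence in the space $D[0,1]$ of càdlàg functions with the Skorokhod metric, and $B$, $B^{(2)}$ are standard Brownian motions started at $0$. Let $Y_0=0$ and $Y_t=Y_{t-1}+\epsilon_t$ for $t\ge1$. Let $K:\mathbb{R}\to[0,\infty)$ be bounded, of class $C^2$ with bounded derivative, of bounded variation, with $\int K(z)\,dz=1$ and $\int zK(z)\,dz=0$ (both integrals absolutely convergent). Let $h=h_T$ satisfy $T/h_T\to\zeta$ as $T\to\infty$ for some $1\le\zeta<\infty$, let $\kappa\in(0,1)$, $k=\lfloor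 T\kappa\rfloor$, $\sigma^2=E\epsilon_1^2$ and $\vartheta=\eta/\sigma$. For $s\in[0,1]$ put (with $0/0=0$) $$D_T(s)=\frac{\lfloor Ts\rfloor^{-1}\sum_{t=1}^{\lfloor Ts\rfloor}Y_{t-1}(Y_t-Y_{t-1})K((\lfloor Ts\rfloor-t)/h)}{\lfloor Ts\rfloor^{-2}\sum_{t=1}^{\lfloor Ts\rfloor}Y_{t-1}^2},$$ and for $s\in(0,1]$ $$\mathcal{D}_\vartheta(s)=\frac{\frac s2\left\{K(0)B(s)^2+\zeta\int_0^sB(r)^2K'(\zeta(s-r))\,dr-\vartheta^{-2}\int_0^sK(\zeta(s-r))\,dr\right\}}{\int_0^sB(r)^2\,dr}.$$ Then for every control limit $c<0$ the stopping time $S_T=\inf\{k\le t\le T: D_T(t/T)<c\}$ satisfies $$S_T/T\ \stackrel{d}{\to}\ \inf\{s\in[\kappa,1]:\mathcal{D}_\vartheta(s)<c\},\qquad T\to\infty,$$ where $\inf\emptyset=\infty$ and convergence in distribution is that of extended-real-valued random variables. -/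

import Mathlib

open MeasureTheory ProbabilityTheory Filter Set
open scoped Topology NNReal ENNReal

noncomputable section

namespace DickeyFuller

/-! ### The Skorokhod space `D[0,1]` -/

/-- A function on `[0,1]` is càdlàg: right-continuous with left limits. -/
structure IsCadlag (f : unitInterval → ℝ) : Prop where
  right_continuous : ∀ t, ContinuousWithinAt f (Ici t) t
  left_limit : ∀ t, ∃ l : ℝ, Tendsto f (𝓝[<] t) (𝓝 l)

/-- The space `D[0,1]` of real càdlàg functions on `[0,1]`. -/
@[ext]
structure SkorokhodD where
  toFun : unitInterval → ℝ
  cadlag : IsCadlag toFun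

/-- The cost of the time change `lam` (an increasing bijection of `[0,1]`) between `x` and `y`:
the larger one of `sup_t |lam t - t|` and `sup_t |x t - y (lam t)|`. -/
def timeChangeCost (x y : SkorokhodD) (lam : unitInterval ≃o unitInterval) : ℝ≥0∞ :=
  max (⨆ t : unitInterval, edist (lam t) t) (⨆ t : unitInterval, edist (x.toFun t) (y.toFun (lam t)))

theorem timeChangeCost_symm (x y : SkorokhodD) (lam : unitInterval ≃o unitInterval) :
    timeChangeCost y x lam.symm ≤ timeChangeCost x y lam := by
  unfold timeChangeCost
  refine max_le_max (iSup_le fun t => ?_) (iSup_le fun t => ?_)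
  · refine le_trans (le_of_eq ?_) (le_iSup _ (lam.symm t))
    rw [OrderIso.apply_symm_apply, edist_comm]
  · refine le_trans (le_of_eq ?_) (le_iSup _ (lam.symm t))
    rw [OrderIso.apply_symm_apply, edist_comm]

theorem timeChangeCost_trans (x y z : SkorokhodD) (l m : unitInterval ≃o unitInterval) :
    timeChangeCost x z (l.trans m) ≤ timeChangeCost x y l + timeChangeCost y z m := by
  unfold timeChangeCost
  refine max_le (iSup_le fun t => ?_) (iSup_le fun t => ?_)
  · calc edist ((l.trans m) t) t
        ≤ edist (m (l t)) (l t) + edist (l t) t := edist_triangle _ _ _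
      _ = edist (l t) t + edist (m (l t)) (l t) := add_comm _ _
      _ ≤ _ := add_le_add
          (le_trans (le_iSup (fun t : unitInterval => edist (l t) t) t) (le_max_left _ _))
          (le_trans (le_iSup (fun t : unitInterval => edist (m t) t) (l t)) (le_max_left _ _))
  · calc edist (x.toFun t) (z.toFun ((l.trans m) t))
        ≤ edist (x.toFun t) (y.toFun (l t)) + edist (y.toFun (l t)) (z.toFun (m (l t))) :=
          edist_triangle _ _ _
      _ ≤ _ := add_le_add
          (le_trans (le_iSup (fun t : unitInterval => edist (x.toFun t) (y.toFun (l t))) t)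
            (le_max_right _ _))
          (le_trans (le_iSup (fun t : unitInterval => edist (y.toFun t) (z.toFun (m t))) (l t))
            (le_max_right _ _))

/-- The Skorokhod metric
`d(x, y) = inf_lam max (sup_t |lam t - t|) (sup_t |x t - y (lam t)|)`,
the infimum being over all increasing bijections `lam` of `[0,1]`. -/
instance : PseudoEMetricSpace SkorokhodD where
  edist x y := ⨅ lam : unitInterval ≃o unitInterval, timeChangeCost x y lam
  edist_self x := by
    refine le_antisymm (iInf_le_of_le (OrderIso.refl unitInterval) ?_) zero_le
    simp [timeChangeCost]
  edist_comm x y := le_antisymm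
    (le_iInf fun lam => iInf_le_of_le lam.symm (timeChangeCost_symm y x lam))
    (le_iInf fun lam => iInf_le_of_le lam.symm (timeChangeCost_symm x y lam))
  edist_triangle x y z := by
    rw [ENNReal.iInf_add, le_iInf_iff]
    intro l
    rw [ENNReal.add_iInf, le_iInf_iff]
    intro m
    exact iInf_le_of_le (l.trans m) (timeChangeCost_trans x y z l m)

/-- `D[0,1]` carries the Borel σ-algebra of the Skorokhod metric. -/
instance : MeasurableSpace SkorokhodD := borel SkorokhodD

instance : BorelSpace SkorokhodD := ⟨rfl⟩

theorem IsCadlag.of_continuous {f : unitInterval → ℝ} (hf : Continuous f) : IsCadlag f :=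
  ⟨fun _ => hf.continuousWithinAt, fun t => ⟨f t, hf.continuousAt.tendsto.mono_left inf_le_left⟩⟩

open Classical in
/-- A function on `[0,1]` as an element of `D[0,1]`; functions that are not càdlàg (for processes
with a.s. continuous paths: on a null set) are sent to the zero function. -/
def cadlagPath (f : unitInterval → ℝ) : SkorokhodD :=
  if hf : IsCadlag f then ⟨f, hf⟩ else ⟨fun _ => 0, .of_continuous continuous_const⟩

theorem isCadlag_step (f : ℕ → ℝ) (T : ℕ) :
    IsCadlag (fun s : unitInterval => f ⌊(T : ℝ) * (s : ℝ)⌋₊) := by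
  have hcont : Continuous fun u : unitInterval => (T : ℝ) * (u : ℝ) := by fun_prop
  refine ⟨fun s => ?_, fun s => ?_⟩
  · refine ContinuousWithinAt.congr_of_eventuallyEq
      (f := fun _ => f ⌊(T : ℝ) * (s : ℝ)⌋₊) continuousWithinAt_const ?_ rfl
    have h1 : ∀ᶠ u : unitInterval in 𝓝[≥] s, (T : ℝ) * (u : ℝ) < ⌊(T : ℝ) * (s : ℝ)⌋₊ + 1 :=
      (hcont.continuousAt.eventually_lt continuousAt_const
        (Nat.lt_floor_add_one ((T : ℝ) * (s : ℝ)))).filter_mono inf_le_left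
    filter_upwards [h1, self_mem_nhdsWithin] with u hu hsu
    have hsu' : (s : ℝ) ≤ u := hsu
    have h0 : 0 ≤ (T : ℝ) * (s : ℝ) := mul_nonneg (Nat.cast_nonneg _) s.2.1
    have h2 : (T : ℝ) * (s : ℝ) ≤ (T : ℝ) * (u : ℝ) :=
      mul_le_mul_of_nonneg_left hsu' (Nat.cast_nonneg _)
    congr 1
    exact (Nat.floor_eq_iff (h0.trans h2)).2 ⟨(Nat.floor_le h0).trans h2, hu⟩
  · refine ⟨f (⌈(T : ℝ) * (s : ℝ)⌉₊ - 1), tendsto_const_nhds.congr' ?_⟩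
    rcases (mul_nonneg (Nat.cast_nonneg (α := ℝ) T) s.2.1).eq_or_lt with h0 | h0
    · refine Eventually.mono self_mem_nhdsWithin fun u hu => ?_
      have hu' : (u : ℝ) < s := hu
      have hT : (T : ℝ) = 0 := by
        rcases mul_eq_zero.1 h0.symm with h | h
        · exact h
        · have := u.2.1
          linarith
      simp [hT]
    · have hpos : 1 ≤ ⌈(T : ℝ) * (s : ℝ)⌉₊ := Nat.one_le_iff_ne_zero.2 (Nat.ceil_pos.2 h0).ne'
      have hlt : ((⌈(T : ℝ) * (s : ℝ)⌉₊ - 1 : ℕ) : ℝ) < (T : ℝ) * (s : ℝ) := by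
        rw [← Nat.lt_ceil]; omega
      have h1 : ∀ᶠ u : unitInterval in 𝓝[<] s, ((⌈(T : ℝ) * (s : ℝ)⌉₊ - 1 : ℕ) : ℝ) < (T : ℝ) * (u : ℝ) :=
        (continuousAt_const.eventually_lt hcont.continuousAt hlt).filter_mono inf_le_left
      filter_upwards [h1, self_mem_nhdsWithin] with u hu hus
      have hus' : (u : ℝ) < s := hus
      have hT : (0 : ℝ) < T := by
        rcases (Nat.cast_nonneg (α := ℝ) T).eq_or_lt with h | h
        · rw [← h] at h0; simp at h0
        · exact h
      congr 1
      symm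
      refine (Nat.floor_eq_iff (mul_nonneg (Nat.cast_nonneg _) u.2.1)).2 ⟨hu.le, ?_⟩
      have h3 : (T : ℝ) * (u : ℝ) < (T : ℝ) * (s : ℝ) := mul_lt_mul_of_pos_left hus' hT
      have h4 := Nat.le_ceil ((T : ℝ) * (s : ℝ))
      have h5 : ((⌈(T : ℝ) * (s : ℝ)⌉₊ - 1 : ℕ) : ℝ) + 1 = ⌈(T : ℝ) * (s : ℝ)⌉₊ := by
        rw [Nat.cast_sub hpos]; simp
      linarith

/-! ### Assumptions on the errors -/

variable {Ω Ω' Ω₂ : Type*} [MeasurableSpace Ω] [MeasurableSpace Ω'] [MeasurableSpace Ω₂]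

/-- The partial sum process `s ↦ T^{-1/2} ∑_{1 ≤ i ≤ ⌊Ts⌋} X_i`, as a random element of `D[0,1]`. -/
def partialSumPath (X : ℕ → Ω → ℝ) (T : ℕ) (ω : Ω) : SkorokhodD where
  toFun s := (√(T : ℝ))⁻¹ * ∑ i ∈ Finset.Icc 1 ⌊(T : ℝ) * (s : ℝ)⌋₊, X i ω
  cadlag := isCadlag_step (fun n => (√(T : ℝ))⁻¹ * ∑ i ∈ Finset.Icc 1 n, X i ω) T

/-- The path `s ↦ a * B(s)`, `s ∈ [0,1]`, as a random element of `D[0,1]`. -/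
def scaledPath (a : ℝ) (B : ℝ≥0 → Ω' → ℝ) (ω : Ω') : SkorokhodD :=
  cadlagPath fun s => a * B (unitInterval.toNNReal s) ω

/-- Functional central limit theorem: `T^{-1/2} ∑_{i ≤ ⌊Ts⌋} X_i ⇒ a B(s)`, weakly in `D[0,1]`. -/
def FCLT (X : ℕ → Ω → ℝ) (P : Measure Ω) [IsProbabilityMeasure P]
    (a : ℝ) (B : ℝ≥0 → Ω' → ℝ) (P' : Measure Ω') [IsProbabilityMeasure P'] : Prop :=
  TendstoInDistribution (partialSumPath X) atTop (scaledPath a B) (fun _ => P) P'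

/-- Strict stationarity of `X_1, X_2, …` (the index `0` is not used): for all times
`t_1, …, t_n ≥ 1` and every shift `m`, the vectors `(X_{t_1}, …, X_{t_n})` and
`(X_{t_1 + m}, …, X_{t_n + m})` have the same law. -/
def StrictlyStationary (X : ℕ → Ω → ℝ) (P : Measure Ω) : Prop :=
  ∀ (m n : ℕ) (t : Fin n → ℕ), (∀ i, 1 ≤ t i) →
    IdentDistrib (fun ω i => X (t i) ω) (fun ω i => X (t i + m) ω) P P

/-- The assumptions on the error terms `ε_1, ε_2, …`. -/
structure ErrorAssumptions (ε : ℕ → Ω → ℝ) (P : Measure Ω) [IsProbabilityMeasure P]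
    (η η' : ℝ) (B : ℝ≥0 → Ω' → ℝ) (P' : Measure Ω') [IsProbabilityMeasure P']
    (B₂ : ℝ≥0 → Ω₂ → ℝ) (P₂ : Measure Ω₂) [IsProbabilityMeasure P₂] : Prop where
  stationary : StrictlyStationary ε P
  fourth_moment : MemLp (ε 1) 4 P
  mean_zero : P[ε 1] = 0
  /-- The series `∑_{t ≥ 1} Cov(ε_1², ε_{1+t}²)` converges. -/
  cov_series : ∃ l : ℝ, Tendsto
    (fun n : ℕ => ∑ t ∈ Finset.Icc 1 n, cov[fun ω => ε 1 ω ^ 2, fun ω => ε (1 + t) ω ^ 2; P])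
    atTop (𝓝 l)
  η_pos : 0 < η
  η'_pos : 0 < η'
  fclt : FCLT ε P η B P'
  fclt_sq : FCLT (fun i ω => ε i ω ^ 2 - ∫ ω', ε i ω' ^ 2 ∂P) P η' B₂ P₂

/-- The AR(1) model `Y_0 = 0`, `Y_t = ρ Y_{t-1} + ε_t`, `t ≥ 1`. -/
def IsAR1 (ρ : ℝ) (ε Y : ℕ → Ω → ℝ) : Prop :=
  ∀ ω, Y 0 ω = 0 ∧ ∀ t : ℕ, Y (t + 1) ω = ρ * Y t ω + ε (t + 1) ω

/-! ### Assumptions on the kernel -/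

structure KernelAssumptions (K : ℝ → ℝ) : Prop where
  nonneg : ∀ z, 0 ≤ K z
  bounded : ∃ C, ∀ z, |K z| ≤ C
  integrable : Integrable K
  integral_eq_one : ∫ z, K z = 1
  integrable_mul : Integrable fun z => z * K z
  integral_mul_eq_zero : ∫ z, z * K z = 0
  contDiff : ContDiff ℝ 2 K
  deriv_bounded : ∃ C, ∀ z, |deriv K z| ≤ C
  boundedVariation : BoundedVariationOn K univ

/-! ### The weighted Dickey-Fuller process, the stopping time and the limit process -/

/-- The kernel-weighted Dickey-Fuller process
`D_T(s) = (⌊Ts⌋⁻¹ ∑_{t=1}^{⌊Ts⌋} Y_{t-1} (Y_t - Y_{t-1}) K((⌊Ts⌋ - t)/h_T))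
  / (⌊Ts⌋⁻² ∑_{t=1}^{⌊Ts⌋} Y_{t-1}²)`, with `0 / 0 = 0`. -/
def dfProcess (K : ℝ → ℝ) (h : ℕ → ℝ) (Y : ℕ → Ω → ℝ) (T : ℕ) (s : ℝ) (ω : Ω) : ℝ :=
  let n : ℕ := ⌊(T : ℝ) * s⌋₊
  ((n : ℝ)⁻¹ * ∑ t ∈ Finset.Icc 1 n,
      Y (t - 1) ω * (Y t ω - Y (t - 1) ω) * K (((n : ℝ) - t) / h T)) /
    (((n : ℝ) ^ 2)⁻¹ * ∑ t ∈ Finset.Icc 1 n, Y (t - 1) ω ^ 2)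

/-- The stopping time `S_T = inf {k ≤ t ≤ T : D_T(t/T) < c}` with `k = ⌊Tκ⌋` and
`inf ∅ = ∞`. -/
def stoppingTime (K : ℝ → ℝ) (h : ℕ → ℝ) (Y : ℕ → Ω → ℝ) (κ c : ℝ) (T : ℕ) (ω : Ω) : EReal :=
  sInf ((fun t : ℕ => ((t : ℝ) : EReal)) ''
    {t : ℕ | ⌊(T : ℝ) * κ⌋₊ ≤ t ∧ t ≤ T ∧ dfProcess K h Y T ((t : ℝ) / T) ω < c})

/-- The limit process `𝒟_ϑ(s)` driven by `B`. -/
def limitProcess (K : ℝ → ℝ) (ζ θ : ℝ) (B : ℝ≥0 → Ω' → ℝ) (s : ℝ) (ω : Ω') : ℝ :=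
  (s / 2 * (K 0 * B s.toNNReal ω ^ 2
      + ζ * (∫ r in (0 : ℝ)..s, B r.toNNReal ω ^ 2 * deriv K (ζ * (s - r)))
      - (θ ^ 2)⁻¹ * (∫ r in (0 : ℝ)..s, K (ζ * (s - r))))) /
    (∫ r in (0 : ℝ)..s, B r.toNNReal ω ^ 2)

/-- The limit time `inf {s ∈ [κ,1] : 𝒟_ϑ(s) < c}` with `inf ∅ = ∞`. -/
def limitTime (K : ℝ → ℝ) (ζ θ : ℝ) (B : ℝ≥0 → Ω' → ℝ) (κ c : ℝ) (ω : Ω') : EReal :=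
  sInf ((fun s : ℝ => (s : EReal)) '' {s : ℝ | s ∈ Icc κ 1 ∧ limitProcess K ζ θ B s ω < c})

end DickeyFuller

end

/-! The product `Y_{t-1} (Y_t - Y_{t-1})` is half the increment of `Y_t² - ∑_{i ≤ t} ε_i²`.
Summation by parts moves the differencing onto the kernel, so no stochastic integral has to be
passed to the limit: for `t ≥ 1`, `D_T(t/T) < c` holds exactly when the functional `crossing` of the
rescaled paths `(Y² - ∑ ε²)/T` and `Y²/T` is negative at `t/T` (`div_lt_iff_crossing`). This
functional is continuous under uniform convergence (`tendsto_crossing`), and the sign of its limit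
`G(s)` decides whether `𝒟_ϑ(s) < c` (`lt_iff_crossing_lt_zero`).

The two functional limit theorems are not assumed to hold jointly. The second only bounds `T^{-1/2}
|∑ (ε² - σ²)|` by `T^{1/4}` outside events of vanishing probability, which makes `∑ ε² / T`
deterministic in the limit. On the remaining events the first one suffices:
`limsup_measure_le_of_tendstoInDistribution` reduces the claim to convergent sequences of individual
paths, without changing the probability space.

Along such a sequence the hitting times converge (`tendsto_hittingTime`) unless `G` touches `0`
before becoming negative. Excluding this is the core, `ae_crossing_pos`. Split `B(r)` into a bridge
independent of `ξ = B(t)` and `(min(r,t)/t) ξ`; then `G(s)` is a quadratic in `ξ` with coefficients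
independent of `ξ`. Given the coefficients, only countably many values of `ξ` keep all these
quadratics nonnegative and yet allow a linear descent below `0` when `ξ` is moved. Since `ξ` has no
atoms, the derivative in `ξ` vanishes at every touching time `s`
(`ae_derivative_eq_zero_of_touching`). As `t` runs through the rationals, the point mass `K(0) B(s)`
at `s` together with the density `B(r) (ζ K'(ζ(s-r)) - 2c/s)` annihilates every `min(·,t)`, so both
vanish. Then `G(s) = 0` reduces to `∫ K(ζ(s-r)) dr = 0`; hence `K`, and `K'` at this minimum, vanish
at `ζ(s-r)`, which forces `B(r) = 0` on `(0,s)`. Almost surely `B(κ/2) ≠ 0`, a contradiction. -/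

noncomputable section

namespace DickeyFuller

section

variable {Ω Ω' : Type*} [MeasurableSpace Ω] [MeasurableSpace Ω']

/-! ### Portmanteau inequality along sequences -/

/-- If `X n` tends to `Z` in distribution, then `limsup P (A n) ≤ P' C` as soon as, for almost
every `ω`, a sequence `X (τ j) (w j)` with `w j ∈ A (τ j)` can converge to `Z ω` only if
`ω ∈ C`. -/
theorem limsup_measure_le_of_tendstoInDistribution {D : Type*} [PseudoEMetricSpace D]
    [MeasurableSpace D] [BorelSpace D] {P : Measure Ω} [IsProbabilityMeasure P] {P' : Measure Ω'}
    [IsProbabilityMeasure P'] {X : ℕ → Ω → D} {Z : Ω' → D}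
    (hX : TendstoInDistribution X atTop Z (fun _ => P) P') (A : ℕ → Set Ω) (C : Set Ω')
    (h : ∀ᵐ ω ∂P', ∀ (τ : ℕ → ℕ) (w : ℕ → Ω), Tendsto τ atTop atTop → (∀ j, w j ∈ A (τ j)) →
      Tendsto (fun j => X (τ j) (w j)) atTop (𝓝 (Z ω)) → ω ∈ C) :
    limsup (fun n => P (A n)) atTop ≤ P' C := by
  -- The Portmanteau bound is applied to each fixed closed set `G N`, and only then `N → ∞`. A point
  -- of every `G N` is a limit of values of `X n` on `A n` with `n` arbitrarily large, which is the
  -- situation the hypothesis covers.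
  set G : ℕ → Set D := fun N => closure (⋃ n ≥ N, X n '' A n) with hG
  have h1 : ∀ N, limsup (fun n => P (A n)) atTop ≤ P' (Z ⁻¹' G N) := by
    intro N
    have h2 := ProbabilityMeasure.limsup_measure_closed_le_of_tendsto hX.tendsto
      (F := G N) isClosed_closure
    simp only [ProbabilityMeasure.coe_mk] at h2
    rw [Measure.map_apply_of_aemeasurable hX.aemeasurable_limit
      isClosed_closure.measurableSet] at h2
    refine le_trans ?_ h2
    refine limsup_le_limsup ?_
    filter_upwards [eventually_ge_atTop N] with n hn
    rw [Measure.map_apply_of_aemeasurable (hX.forall_aemeasurable n)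
      isClosed_closure.measurableSet]
    refine measure_mono fun w hw => subset_closure ?_
    exact mem_iUnion₂.2 ⟨n, hn, w, hw, rfl⟩
  have hanti : Antitone fun N => Z ⁻¹' G N := by
    intro M N hMN
    refine preimage_mono (closure_mono ?_)
    exact biUnion_subset_biUnion_left fun n hn => le_trans hMN hn
  have h3 : Tendsto (fun N => P' (Z ⁻¹' G N)) atTop (𝓝 (P' (⋂ N, Z ⁻¹' G N))) :=
    tendsto_measure_iInter_atTop (fun N => hX.aemeasurable_limit.nullMeasurableSet_preimage
      isClosed_closure.measurableSet) hanti ⟨0, measure_ne_top _ _⟩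
  refine (ge_of_tendsto' h3 h1).trans (measure_mono_ae ?_)
  filter_upwards [h] with ω hω hmem
  have h4 : ∀ N : ℕ, ∃ n ≥ N, ∃ w ∈ A n, edist (Z ω) (X n w) < ((N : ℝ≥0∞) + 1)⁻¹ := by
    intro N
    have h5 : Z ω ∈ G N := mem_iInter.1 hmem N
    obtain ⟨y, hy, hd⟩ := EMetric.mem_closure_iff.1 h5 ((N : ℝ≥0∞) + 1)⁻¹
      (ENNReal.inv_pos.2 (by finiteness))
    obtain ⟨n, hn, w, hw, rfl⟩ := mem_iUnion₂.1 hy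
    exact ⟨n, hn, w, hw, hd⟩
  choose τ hτ w hw hd using h4
  refine hω τ w (tendsto_atTop_mono hτ tendsto_id) hw ?_
  rw [tendsto_iff_edist_tendsto_0]
  refine tendsto_of_tendsto_of_tendsto_of_le_of_le tendsto_const_nhds
    (h := fun N : ℕ => ((N : ℝ≥0∞) + 1)⁻¹) ?_ (fun _ => zero_le)
    (fun N => by rw [edist_comm]; exact (hd N).le)
  have := ENNReal.tendsto_inv_nat_nhds_zero.comp (tendsto_add_atTop_nat 1)
  simpa [Function.comp_def] using this

/-! ### Skorokhod convergence to a continuous limit -/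

/-- A cheap time change moves every point only slightly, and uniform continuity of the limit absorbs
that displacement. -/
theorem tendstoUniformly_of_tendsto_skorokhod {x : ℕ → SkorokhodD} {y : SkorokhodD}
    (hy : Continuous y.toFun) (h : Tendsto x atTop (𝓝 y)) :
    TendstoUniformly (fun j => (x j).toFun) y.toFun atTop := by
  have huc := CompactSpace.uniformContinuous_of_continuous hy
  rw [EMetric.tendstoUniformly_iff]
  intro e he
  obtain ⟨d, hd, hde⟩ := EMetric.uniformContinuous_iff.1 huc (e / 2) (ENNReal.half_pos he.ne')
  rw [tendsto_iff_edist_tendsto_0] at h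
  have hm : 0 < min d (e / 2) := lt_min hd (ENNReal.half_pos he.ne')
  filter_upwards [h.eventually_lt_const hm] with j hj s
  obtain ⟨lam, hlam⟩ := iInf_lt_iff.1 (show (⨅ lam, timeChangeCost (x j) y lam) < _ from hj)
  have h1 : edist (lam s) s < d :=
    lt_of_le_of_lt ((le_iSup (fun t : unitInterval => edist (lam t) t) s).trans
      (le_max_left _ _)) (hlam.trans_le (min_le_left _ _))
  have h2 : edist ((x j).toFun s) (y.toFun (lam s)) < e / 2 :=
    lt_of_le_of_lt ((le_iSup (fun t : unitInterval =>
      edist ((x j).toFun t) (y.toFun (lam t))) s).trans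
      (le_max_right _ _)) (hlam.trans_le (min_le_right _ _))
  calc edist (y.toFun s) ((x j).toFun s)
      ≤ edist (y.toFun s) (y.toFun (lam s)) + edist (y.toFun (lam s)) ((x j).toFun s) :=
        edist_triangle _ _ _
    _ < e / 2 + e / 2 := ENNReal.add_lt_add (by rw [edist_comm]; exact hde h1)
        (by rw [edist_comm]; exact h2)
    _ = e := ENNReal.add_halves e

theorem scaledPath_toFun {Ω' : Type*} {B : ℝ≥0 → Ω' → ℝ} {ω : Ω'} (h : Continuous (B · ω)) (a : ℝ)
    (s : unitInterval) : (scaledPath a B ω).toFun s = a * B (unitInterval.toNNReal s) ω := by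
  have hc : Continuous fun s : unitInterval => a * B (unitInterval.toNNReal s) ω := by
    have := h.comp unitInterval.toNNReal_continuous
    exact continuous_const.mul this
  simp [scaledPath, cadlagPath, IsCadlag.of_continuous hc]

theorem continuous_scaledPath {Ω' : Type*} {B : ℝ≥0 → Ω' → ℝ} {ω : Ω'} (h : Continuous (B · ω)) (a : ℝ) :
    Continuous (scaledPath a B ω).toFun := by
  have : (scaledPath a B ω).toFun = fun s => a * B (unitInterval.toNNReal s) ω :=
    funext (scaledPath_toFun h a)
  rw [this]
  exact continuous_const.mul (h.comp unitInterval.toNNReal_continuous)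

/-- A weakly convergent sequence of processes with a continuous limit is `o(T ^ (1/4))`. -/
theorem tendsto_measure_exists_le_abs {P : Measure Ω} [IsProbabilityMeasure P] {P' : Measure Ω'}
    [IsProbabilityMeasure P'] {X : ℕ → Ω → SkorokhodD} {Z : Ω' → SkorokhodD}
    (hX : TendstoInDistribution X atTop Z (fun _ => P) P')
    (hZ : ∀ᵐ ω ∂P', Continuous (Z ω).toFun) {r : ℕ → ℝ} (hr : Tendsto r atTop atTop) :
    Tendsto (fun T => P {ω | ∃ s, r T ≤ |(X T ω).toFun s|}) atTop (𝓝 0) := by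
  -- The target set is empty: paths exceeding `r T → ∞` somewhere cannot converge uniformly to a
  -- bounded path.
  have h := limsup_measure_le_of_tendstoInDistribution hX
    (fun T => {ω | ∃ s, r T ≤ |(X T ω).toFun s|}) ∅ ?_
  · rw [measure_empty] at h
    exact tendsto_of_le_liminf_of_limsup_le zero_le h
  filter_upwards [hZ] with ω hω τ w hτ hw hlim
  exfalso
  have hu := Metric.tendstoUniformly_iff.1 (tendstoUniformly_of_tendsto_skorokhod hω hlim) 1
    one_pos
  obtain ⟨M, hM⟩ := (isCompact_range hω).isBounded.exists_norm_le
  obtain ⟨j, hj1, hj2⟩ := (hu.and ((hr.comp hτ).eventually_gt_atTop (M + 1))).exists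
  obtain ⟨s, hs⟩ := hw j
  have h1 := hj1 s
  have h2 := hM _ (mem_range_self s)
  rw [Real.dist_eq] at h1
  rw [Real.norm_eq_abs] at h2
  simp only [Function.comp_apply] at hj2
  have h3 := abs_sub_abs_le_abs_sub ((X (τ j) (w j)).toFun s) ((Z ω).toFun s)
  rw [abs_sub_comm] at h3
  linarith

end

/-! ### The Dickey-Fuller statistic as a functional of the path -/

/-- `K(0) U(s) + z ∫₀ˢ U(r) K'(z (s - r)) dr`. -/
def kernelFunctional (K : ℝ → ℝ) (z : ℝ) (U : ℝ → ℝ) (s : ℝ) : ℝ :=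
  K 0 * U s + ∫ r in (0 : ℝ)..s, U r * (z * deriv K (z * (s - r)))

/-- The functional whose sign decides whether the Dickey-Fuller process is below `c`. -/
def crossing (K : ℝ → ℝ) (z c : ℝ) (U V : ℝ → ℝ) (s : ℝ) : ℝ :=
  kernelFunctional K z U s - 2 * c / s * ∫ r in (0 : ℝ)..s, V r

theorem summation_by_parts (u a : ℕ → ℝ) (h0 : u 0 = 0) (n : ℕ) :
    ∑ t ∈ Finset.Icc 1 n, (u t - u (t - 1)) * a t
      = u n * a n + ∑ i ∈ Finset.range n, u i * (a i - a (i + 1)) := by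
  induction n with
  | zero => simp [h0]
  | succ n ih =>
    rw [Finset.sum_Icc_succ_top (by omega), ih, Finset.sum_range_succ]
    simp only [Nat.add_sub_cancel]
    ring

theorem natFloor_mul_of_mem_Ioo {T i : ℕ} (hT : 0 < T) {r : ℝ}
    (hr : r ∈ Ioo ((i : ℝ) / T) ((i + 1 : ℕ) / T)) : ⌊(T : ℝ) * r⌋₊ = i := by
  have hT' : (0 : ℝ) < T := by exact_mod_cast hT
  have h1 := (div_lt_iff₀ hT').1 hr.1
  have h2 := (lt_div_iff₀ hT').1 hr.2
  push_cast at h2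
  refine (Nat.floor_eq_iff (by nlinarith [(Nat.cast_nonneg i : (0 : ℝ) ≤ i)])).2
    ⟨by linarith, by linarith⟩

theorem integral_step_mul (u : ℕ → ℝ) {T : ℕ} (hT : 0 < T) {φ : ℝ → ℝ} (hφ : Continuous φ)
    (n : ℕ) : ∫ r in (0 : ℝ)..((n : ℝ) / T), u ⌊(T : ℝ) * r⌋₊ * φ r
      = ∑ i ∈ Finset.range n, u i * ∫ r in ((i : ℝ) / T)..((i + 1 : ℕ) / T), φ r := by
  have hle : ∀ i : ℕ, (i : ℝ) / T ≤ ((i + 1 : ℕ) : ℝ) / T := fun i => by gcongr; simp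
  have heq : ∀ i : ℕ, EqOn (fun r => u i * φ r) (fun r => u ⌊(T : ℝ) * r⌋₊ * φ r)
      (Ioo ((i : ℝ) / T) (((i + 1 : ℕ) : ℝ) / T)) := fun i r hr => by
    simp only [natFloor_mul_of_mem_Ioo hT hr]
  have h := intervalIntegral.sum_integral_adjacent_intervals (μ := volume)
    (f := fun r => u ⌊(T : ℝ) * r⌋₊ * φ r) (a := fun i : ℕ => (i : ℝ) / T) (n := n)
    (fun i _ => ((hφ.const_mul (u i)).intervalIntegrable _ _).congr_uIoo
      (by rw [uIoo_of_le (hle i)]; exact heq i))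
  simp only [Nat.cast_zero, zero_div] at h
  rw [← h]
  refine Finset.sum_congr rfl fun i _ => ?_
  rw [← intervalIntegral.integral_const_mul]
  exact (intervalIntegral.integral_congr_Ioo_of_le (hle i) (heq i)).symm

theorem integral_deriv_kernel {K : ℝ → ℝ} (hK : ContDiff ℝ 2 K) (z s a b : ℝ) :
    ∫ r in a..b, z * deriv K (z * (s - r)) = K (z * (s - a)) - K (z * (s - b)) := by
  have hc : Continuous (deriv K) := hK.continuous_deriv (by norm_num)
  have hd : ∀ r : ℝ, HasDerivAt (fun r => - K (z * (s - r))) (z * deriv K (z * (s - r))) r := by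
    intro r
    have h1 : HasDerivAt (fun r : ℝ => z * (s - r)) (-z) r := by
      simpa using ((hasDerivAt_id r).const_sub s).const_mul z
    have h2 : HasDerivAt K (deriv K (z * (s - r))) (z * (s - r)) :=
      ((hK.differentiable (by norm_num)) _).hasDerivAt
    have h3 : HasDerivAt (fun r => - K (z * (s - r))) (-(deriv K (z * (s - r)) * -z)) r :=
      (h2.comp r h1).neg
    exact h3.congr_deriv (by ring)
  rw [intervalIntegral.integral_eq_sub_of_hasDerivAt (fun r _ => hd r)
    (Continuous.intervalIntegrable (by fun_prop) _ _)]
  ring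

/-- An exact identity rather than a Riemann sum approximation: after summation by parts, each
difference of kernel weights is the integral of the derivative over one cell, where the step path is
constant. -/
theorem sum_increment_mul_kernel {K : ℝ → ℝ} (hK : ContDiff ℝ 2 K) (u : ℕ → ℝ) (h0 : u 0 = 0)
    (h : ℝ) {T : ℕ} (hT : 0 < T) (n : ℕ) :
    ∑ t ∈ Finset.Icc 1 n, (u t - u (t - 1)) * K (((n : ℝ) - t) / h)
      = kernelFunctional K (T / h) (fun r => u ⌊(T : ℝ) * r⌋₊) (n / T) := by
  have hc : Continuous (deriv K) := hK.continuous_deriv (by norm_num)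
  have hT' : (T : ℝ) ≠ 0 := by exact_mod_cast hT.ne'
  have harg : ∀ i : ℕ, (T : ℝ) / h * ((n : ℝ) / T - (i : ℝ) / T) = ((n : ℝ) - i) / h := by
    intro i
    rw [← sub_div, div_mul_div_comm, mul_comm h, mul_div_mul_left _ _ hT']
  rw [summation_by_parts u (fun t => K (((n : ℝ) - t) / h)) h0, kernelFunctional,
    integral_step_mul u hT (φ := fun r => (T : ℝ) / h * deriv K ((T : ℝ) / h * ((n : ℝ) / T - r)))
      (by fun_prop)]
  congr 1
  · rw [mul_div_cancel₀ _ hT', Nat.floor_natCast]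
    simp [mul_comm]
  · refine Finset.sum_congr rfl fun i _ => ?_
    rw [integral_deriv_kernel hK, harg, harg]

/-- The sequence `y_n² - ∑_{i ≤ n} (y_i - y_{i-1})²`. -/
def compensatedSq (y : ℕ → ℝ) (n : ℕ) : ℝ :=
  y n ^ 2 - ∑ i ∈ Finset.Icc 1 n, (y i - y (i - 1)) ^ 2

theorem compensatedSq_sub (y : ℕ → ℝ) {t : ℕ} (ht : 1 ≤ t) :
    compensatedSq y t - compensatedSq y (t - 1) = 2 * (y (t - 1) * (y t - y (t - 1))) := by
  obtain ⟨n, rfl⟩ : ∃ n, t = n + 1 := ⟨t - 1, by omega⟩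
  simp only [compensatedSq, Nat.add_sub_cancel]
  rw [Finset.sum_Icc_succ_top (by omega)]
  simp only [Nat.add_sub_cancel]
  ring

theorem div_lt_iff_crossing {K : ℝ → ℝ} (hK : ContDiff ℝ 2 K) (y : ℕ → ℝ) (h0 : y 0 = 0)
    (h : ℝ) {T : ℕ} (hT : 0 < T) {n : ℕ} (hn : 0 < n) {c : ℝ} (hc : c < 0) :
    ((n : ℝ)⁻¹ * ∑ t ∈ Finset.Icc 1 n, y (t - 1) * (y t - y (t - 1)) * K (((n : ℝ) - t) / h)) /
      (((n : ℝ) ^ 2)⁻¹ * ∑ t ∈ Finset.Icc 1 n, y (t - 1) ^ 2) < c ↔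
    crossing K (T / h) c (fun r => compensatedSq y ⌊(T : ℝ) * r⌋₊ / T)
      (fun r => y ⌊(T : ℝ) * r⌋₊ ^ 2 / T) (n / T) < 0 := by
  have hT' : (0 : ℝ) < T := by exact_mod_cast hT
  have hn' : (0 : ℝ) < n := by exact_mod_cast hn
  have hnum := sum_increment_mul_kernel hK (fun n => compensatedSq y n / T)
    (by simp [compensatedSq, h0]) h hT n
  have hnum' : ∑ t ∈ Finset.Icc 1 n, (compensatedSq y t / T - compensatedSq y (t - 1) / T) *
      K (((n : ℝ) - t) / h) = 2 / T *
      ∑ t ∈ Finset.Icc 1 n, y (t - 1) * (y t - y (t - 1)) * K (((n : ℝ) - t) / h) := by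
    rw [Finset.mul_sum]
    refine Finset.sum_congr rfl fun t ht => ?_
    rw [← sub_div, compensatedSq_sub y (Finset.mem_Icc.1 ht).1]
    ring
  rw [hnum'] at hnum
  have hden : ∫ r in (0 : ℝ)..((n : ℝ) / T), y ⌊(T : ℝ) * r⌋₊ ^ 2 / T
      = (1 / T ^ 2) * ∑ t ∈ Finset.Icc 1 n, y (t - 1) ^ 2 := by
    have h1 := integral_step_mul (fun i => y i ^ 2 / T) hT (continuous_const (y := (1 : ℝ))) n
    simp only [mul_one] at h1
    rw [h1, Finset.mul_sum, Finset.range_eq_Ico, Finset.sum_Ico_eq_sum_range,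
      ← Finset.Ico_add_one_right_eq_Icc, Finset.sum_Ico_eq_sum_range]
    refine Finset.sum_congr (by simp) fun i _ => ?_
    simp only [intervalIntegral.integral_const, smul_eq_mul, mul_one, Nat.add_sub_cancel_left,
      zero_add]
    push_cast
    field_simp
    ring
  rw [crossing, ← hnum, hden]
  set N := ∑ t ∈ Finset.Icc 1 n, y (t - 1) * (y t - y (t - 1)) * K (((n : ℝ) - t) / h) with hN
  set I := ∑ t ∈ Finset.Icc 1 n, y (t - 1) ^ 2 with hI
  have hI0 : 0 ≤ I := Finset.sum_nonneg fun _ _ => sq_nonneg _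
  rcases hI0.eq_or_lt with hI0 | hI0
  -- Degenerate denominator: the ratio is `0 / 0 = 0`, not below `c < 0`, and the functional is `0`
  -- as well, so both sides are false.
  · have hz : ∀ t ∈ Finset.Icc 1 n, y (t - 1) ^ 2 = 0 :=
      (Finset.sum_eq_zero_iff_of_nonneg fun _ _ => sq_nonneg _).1 (hI ▸ hI0.symm)
    have hN0 : N = 0 := Finset.sum_eq_zero fun t ht => by
      rw [pow_eq_zero_iff (by norm_num) |>.1 (hz t ht)]
      ring
    rw [hN0, ← hI0]
    simp [hc.le]
  · rw [div_lt_iff₀ (by positivity)]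
    have e1 : 2 / (T : ℝ) * N - 2 * c / ((n : ℝ) / T) * (1 / (T : ℝ) ^ 2 * I)
        = 2 * n / T * ((n : ℝ)⁻¹ * N - c * (((n : ℝ) ^ 2)⁻¹ * I)) := by
      field_simp
    rw [e1, mul_neg_iff]
    have e2 : (0 : ℝ) < 2 * n / T := by positivity
    constructor
    · intro h
      exact Or.inl ⟨e2, by linarith⟩
    · rintro (h | h)
      · linarith [h.2]
      · linarith [h.1]

/-! ### Continuity of the functional -/

/-- The moving endpoint is turned into an indicator on `[0,1]`, so that dominated convergence
applies; pointwise convergence can fail only at the limiting endpoint, a null set. -/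
theorem tendsto_integral_mul_of_tendstoUniformlyOn {ι : Type*} {l : Filter ι}
    [l.IsCountablyGenerated] {U : ι → ℝ → ℝ} {U₀ : ℝ → ℝ} {p : ι → ℝ × ℝ} {p₀ : ℝ × ℝ}
    {Φ : (ℝ × ℝ) × ℝ → ℝ} (hU : TendstoUniformlyOn U U₀ l (Icc 0 1)) (hUm : ∀ i, Measurable (U i))
    (hU₀ : ContinuousOn U₀ (Icc 0 1)) (hp : Tendsto p l (𝓝 p₀)) (hΦ : Continuous Φ)
    (hpI : ∀ᶠ i in l, (p i).2 ∈ Icc (0 : ℝ) 1) (hp₀ : p₀.2 ∈ Icc (0 : ℝ) 1) :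
    Tendsto (fun i => ∫ r in (0 : ℝ)..(p i).2, U i r * Φ (p i, r)) l
      (𝓝 (∫ r in (0 : ℝ)..p₀.2, U₀ r * Φ (p₀, r))) := by
  obtain ⟨M, hM⟩ := (isCompact_Icc.image_of_continuousOn hU₀).isBounded.exists_norm_le
  obtain ⟨C, hC⟩ := (((isCompact_closedBall p₀ 1).prod (isCompact_Icc (a := (0 : ℝ)) (b := 1))).image
    hΦ).isBounded.exists_norm_le
  have hlim : Tendsto (fun i => ∫ r in (0 : ℝ)..1,
      indicator {x | x ≤ (p i).2} (fun r => U i r * Φ (p i, r)) r) l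
      (𝓝 (∫ r in (0 : ℝ)..1, indicator {x | x ≤ p₀.2} (fun r => U₀ r * Φ (p₀, r)) r)) := by
    refine intervalIntegral.tendsto_integral_filter_of_dominated_convergence
      (fun _ => (M + 1) * C) (Eventually.of_forall fun i => ?_) ?_ (by simp) ?_
    · refine Measurable.aestronglyMeasurable ?_
      refine Measurable.indicator ?_ measurableSet_Iic
      have := hUm i
      have h2 : Measurable fun r => Φ (p i, r) := (hΦ.comp (by fun_prop)).measurable
      exact this.mul h2
    · filter_upwards [Metric.tendstoUniformlyOn_iff.1 hU 1 one_pos,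
        hp (Metric.closedBall_mem_nhds p₀ one_pos)] with i h1 h2
      refine Eventually.of_forall fun r hr => ?_
      rw [uIoc_of_le zero_le_one] at hr
      have hr' : r ∈ Icc (0 : ℝ) 1 := Ioc_subset_Icc_self hr
      refine (norm_indicator_le_norm_self _ _).trans ?_
      rw [norm_mul]
      have h3 : ‖Φ (p i, r)‖ ≤ C := hC _ ⟨(p i, r), ⟨h2, hr'⟩, rfl⟩
      have h4 : ‖U₀ r‖ ≤ M := hM _ ⟨r, hr', rfl⟩
      have h5 : dist (U₀ r) (U i r) < 1 := h1 r hr'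
      have h6 : ‖U i r‖ ≤ M + 1 := by
        have := norm_le_norm_add_norm_sub' (U i r) (U₀ r)
        rw [dist_comm, dist_eq_norm] at h5
        linarith
      exact mul_le_mul h6 h3 (norm_nonneg _) ((norm_nonneg _).trans h6)
    · have hne : ∀ᵐ r : ℝ, r ≠ p₀.2 := by simp [ae_iff]
      filter_upwards [hne] with r hr hrI
      rw [uIoc_of_le zero_le_one] at hrI
      have hr' : r ∈ Icc (0 : ℝ) 1 := Ioc_subset_Icc_self hrI
      have hp2 : Tendsto (fun i => (p i).2) l (𝓝 p₀.2) := (continuous_snd.tendsto _).comp hp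
      have hpt : Tendsto (fun i => U i r * Φ (p i, r)) l (𝓝 (U₀ r * Φ (p₀, r))) := by
        refine (hU.tendsto_at hr').mul ?_
        exact (hΦ.tendsto (p₀, r)).comp (hp.prodMk_nhds tendsto_const_nhds)
      rcases lt_or_gt_of_ne hr with h | h
      · rw [indicator_of_mem (by exact h.le)]
        refine hpt.congr' ?_
        filter_upwards [hp2.eventually_const_lt h] with i hi
        rw [indicator_of_mem (by exact hi.le)]
      · rw [indicator_of_notMem (by simpa using h)]
        refine tendsto_const_nhds.congr' ?_
        filter_upwards [hp2.eventually_lt_const h] with i hi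
        rw [indicator_of_notMem (by simpa using hi)]
  rw [intervalIntegral.integral_indicator hp₀] at hlim
  refine hlim.congr' ?_
  filter_upwards [hpI] with i hi
  rw [intervalIntegral.integral_indicator hi]

theorem tendsto_crossing {ι : Type*} {l : Filter ι} [l.IsCountablyGenerated] {K : ℝ → ℝ}
    (hK : ContDiff ℝ 2 K) (c : ℝ) {U V : ι → ℝ → ℝ} {U₀ V₀ : ℝ → ℝ} {z s : ι → ℝ} {z₀ s₀ : ℝ}
    (hU : TendstoUniformlyOn U U₀ l (Icc 0 1)) (hUm : ∀ i, Measurable (U i))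
    (hU₀ : ContinuousOn U₀ (Icc 0 1))
    (hV : TendstoUniformlyOn V V₀ l (Icc 0 1)) (hVm : ∀ i, Measurable (V i))
    (hV₀ : ContinuousOn V₀ (Icc 0 1)) (hz : Tendsto z l (𝓝 z₀)) (hs : Tendsto s l (𝓝 s₀))
    (hsI : ∀ᶠ i in l, s i ∈ Icc (0 : ℝ) 1) (hs₀ : s₀ ∈ Ioc (0 : ℝ) 1) :
    Tendsto (fun i => crossing K (z i) c (U i) (V i) (s i)) l (𝓝 (crossing K z₀ c U₀ V₀ s₀)) := by
  have hc : Continuous (deriv K) := hK.continuous_deriv (by norm_num)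
  have hs₀' : s₀ ∈ Icc (0 : ℝ) 1 := Ioc_subset_Icc_self hs₀
  have h1 := tendsto_integral_mul_of_tendstoUniformlyOn (p := fun i => (z i, s i)) (p₀ := (z₀, s₀))
    (Φ := fun q => q.1.1 * deriv K (q.1.1 * (q.1.2 - q.2))) hU hUm hU₀ (hz.prodMk_nhds hs)
    (by fun_prop) hsI hs₀'
  have h2 := tendsto_integral_mul_of_tendstoUniformlyOn (p := fun i => (z i, s i)) (p₀ := (z₀, s₀))
    (Φ := fun _ => 1) hV hVm hV₀ (hz.prodMk_nhds hs) (by fun_prop) hsI hs₀'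
  simp only [mul_one] at h2
  have h3 := hU.tendsto_comp (hU₀ s₀ hs₀') (tendsto_nhdsWithin_iff.2 ⟨hs, hsI⟩)
  exact ((h3.const_mul _).add h1).sub ((tendsto_const_nhds.div hs hs₀.1.ne').mul h2)

/-! ### Convergence of hitting times -/

open Classical in
theorem sInf_image_natCast_div (E : Set ℕ) {T : ℕ} (hT : 0 < T) :
    sInf ((fun t : ℕ => ((t : ℝ) : EReal)) '' E) / ((T : ℝ) : EReal)
      = if E.Nonempty then ((((sInf E : ℕ) : ℝ) / T : ℝ) : EReal) else ⊤ := by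
  have hT' : (0 : ℝ) < T := by exact_mod_cast hT
  split_ifs with h
  · have h1 : IsLeast ((fun t : ℕ => ((t : ℝ) : EReal)) '' E) (((sInf E : ℕ) : ℝ) : EReal) := by
      refine ⟨⟨sInf E, Nat.sInf_mem h, rfl⟩, ?_⟩
      rintro _ ⟨t, ht, rfl⟩
      exact EReal.coe_le_coe_iff.2 (by exact_mod_cast Nat.sInf_le ht)
    rw [h1.csInf_eq, EReal.coe_div]
  · rw [not_nonempty_iff_eq_empty.1 h, image_empty, sInf_empty,
      EReal.top_div_of_pos_ne_top (by exact_mod_cast hT) (EReal.coe_ne_top _)]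

theorem tendsto_natFloor_mul_div {τ : ℕ → ℕ} (hτ : Tendsto τ atTop atTop) {s : ℝ} (hs : 0 ≤ s) :
    Tendsto (fun j => (⌊(τ j : ℝ) * s⌋₊ : ℝ) / τ j) atTop (𝓝 s) := by
  have h := (tendsto_nat_floor_mul_div_atTop hs).comp
    (tendsto_natCast_atTop_atTop.comp hτ)
  simpa [Function.comp_def, mul_comm] using h

theorem natFloor_mul_div_le {T : ℕ} {s : ℝ} (hs : 0 ≤ s) : (⌊(T : ℝ) * s⌋₊ : ℝ) / T ≤ s := by
  rcases Nat.eq_zero_or_pos T with h | h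
  · simp [h, hs]
  · have hT' : (0 : ℝ) < T := by exact_mod_cast h
    rw [div_le_iff₀ hT', mul_comm s]
    exact Nat.floor_le (by positivity)

/-- If the rescaled times had a subsequence staying below the limit, an accumulation point `s` would
satisfy `G₀ s ≤ 0` before `G₀` becomes negative, which `hreg` forbids. Conversely, a strictly
negative value of `G₀` persists at nearby grid points. Requiring `hreg` only for rational `x` and `x
= 1` leaves countably many almost sure events to intersect. -/
theorem tendsto_hittingTime {G : ℕ → ℝ → ℝ} {G₀ : ℝ → ℝ} {κ : ℝ} (hκ : κ ∈ Ioo (0 : ℝ) 1)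
    {τ : ℕ → ℕ} (hτ : Tendsto τ atTop atTop)
    (hG : ∀ s ∈ Icc κ 1,
      Tendsto (fun p : ℕ × ℝ => G p.1 p.2) (atTop ×ˢ 𝓝[Icc 0 1] s) (𝓝 (G₀ s)))
    (hreg : ∀ x ∈ Icc κ 1, (x = 1 ∨ ∃ q : ℚ, x = q) → (∀ s ∈ Icc κ x, 0 ≤ G₀ s) →
      ∀ s ∈ Icc κ x, 0 < G₀ s)
    {E : ℕ → Set ℕ}
    (hE : ∀ᶠ j in atTop, E j =
      {t | ⌊(τ j : ℝ) * κ⌋₊ ≤ t ∧ t ≤ τ j ∧ G j ((t : ℝ) / τ j) < 0}) :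
    Tendsto (fun j => sInf ((fun t : ℕ => ((t : ℝ) : EReal)) '' E j) / ((τ j : ℝ) : EReal)) atTop
      (𝓝 (sInf ((fun s : ℝ => (s : EReal)) '' {s | s ∈ Icc κ 1 ∧ G₀ s < 0}))) := by
  classical
  have hpos : ∀ᶠ j in atTop, 0 < τ j := hτ.eventually_gt_atTop 0
  set L : EReal := sInf ((fun s : ℝ => (s : EReal)) '' {s | s ∈ Icc κ 1 ∧ G₀ s < 0}) with hL
  rw [tendsto_order]
  constructor
  · intro a ha
    by_contra hcon
    have hfreq : ∃ᶠ j in atTop,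
        sInf ((fun t : ℕ => ((t : ℝ) : EReal)) '' E j) / ((τ j : ℝ) : EReal) ≤ a := by
      simpa [Filter.Frequently, not_le] using hcon
    obtain ⟨φ, hφ, hφE⟩ := extraction_of_frequently_atTop
      (hfreq.and_eventually (hE.and hpos))
    have hmem : ∀ j, ∃ t : ℕ, ⌊(τ (φ j) : ℝ) * κ⌋₊ ≤ t ∧ t ≤ τ (φ j) ∧
        G (φ j) ((t : ℝ) / τ (φ j)) < 0 ∧ (((t : ℝ) / τ (φ j) : ℝ) : EReal) ≤ a := by
      intro j
      obtain ⟨h1, h2, h3⟩ := hφE j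
      rw [sInf_image_natCast_div _ h3] at h1
      split_ifs at h1 with h4
      · have h5 := Nat.sInf_mem h4
        have h6 := (Set.ext_iff.1 h2 _).1 h5
        exact ⟨_, h6.1, h6.2.1, h6.2.2, h1⟩
      · exact absurd (lt_of_le_of_lt h1 ha) not_top_lt
    choose t ht1 ht2 ht3 ht4 using hmem
    have hIcc : ∀ j, (t j : ℝ) / τ (φ j) ∈ Icc (0 : ℝ) 1 := fun j =>
      ⟨by positivity, div_le_one_of_le₀ (by exact_mod_cast ht2 j) (by positivity)⟩
    obtain ⟨s, hsI, ψ, hψ, hlim⟩ := isCompact_Icc.tendsto_subseq hIcc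
    have hφψ : Tendsto (fun j => φ (ψ j)) atTop atTop :=
      hφ.tendsto_atTop.comp hψ.tendsto_atTop
    have hκs : κ ≤ s := by
      refine le_of_tendsto_of_tendsto' (tendsto_natFloor_mul_div (hτ.comp hφψ) hκ.1.le) hlim
        fun j => ?_
      simp only [Function.comp_apply]
      gcongr
      exact ht1 _
    have hGs : G₀ s ≤ 0 := by
      have h1 := (hG s ⟨hκs, hsI.2⟩).comp (hφψ.prodMk (tendsto_nhdsWithin_iff.2
        ⟨hlim, Eventually.of_forall fun j => hIcc (ψ j)⟩))
      exact le_of_tendsto' h1 fun j => (ht3 (ψ j)).le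
    have hsa : (s : EReal) ≤ a := by
      refine le_of_tendsto' ((continuous_coe_real_ereal.tendsto s).comp hlim) fun j => ?_
      exact ht4 _
    -- The right end of a window containing `s` on which `G₀` is still nonnegative: a rational
    -- strictly between `s` and `L`, or `1` when the level is never crossed.
    obtain ⟨x, hx1, hx2, hx3⟩ : ∃ x : ℝ, s ≤ x ∧ (x = 1 ∨ ∃ q : ℚ, x = q) ∧
        ((x : EReal) < L ∧ x ≤ 1) := by
      by_cases hne : L = ⊤
      · exact ⟨1, hsI.2, Or.inl rfl, by rw [hne]; exact EReal.coe_lt_top _, le_rfl⟩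
      · obtain ⟨q, hq1, hq2⟩ := EReal.lt_iff_exists_rat_btwn.1 (hsa.trans_lt ha)
        have hL1 : L ≤ 1 := by
          by_contra hcon
          apply hne
          rw [hL, sInf_eq_top]
          rintro _ ⟨u, hu, rfl⟩
          exfalso
          apply hcon
          have h1 : L ≤ (u : EReal) := sInf_le ⟨u, hu, rfl⟩
          exact h1.trans (by exact_mod_cast hu.1.2)
        refine ⟨q, ?_, Or.inr ⟨q, rfl⟩, hq2, ?_⟩
        · exact (EReal.coe_lt_coe_iff.1 hq1).le
        · exact_mod_cast (hq2.trans_le hL1).le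
    refine absurd (hreg x ⟨hκs.trans hx1, hx3.2⟩ hx2 (fun u hu => ?_) s ⟨hκs, hx1⟩)
      (not_lt.2 hGs)
    by_contra hneg
    have h1 : L ≤ (u : EReal) := sInf_le ⟨u, ⟨⟨hu.1, hu.2.trans hx3.2⟩, not_le.1 hneg⟩, rfl⟩
    exact absurd (h1.trans (EReal.coe_le_coe_iff.2 hu.2)) (not_le.2 hx3.1)
  · intro a ha
    obtain ⟨_, ⟨s, ⟨hsI, hs⟩, rfl⟩, hsa⟩ := sInf_lt_iff.1 ha
    have hs0 : 0 ≤ s := hκ.1.le.trans hsI.1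
    have hfl : ∀ j, (⌊(τ j : ℝ) * s⌋₊ : ℝ) / τ j ∈ Icc (0 : ℝ) 1 := fun j =>
      ⟨by positivity, (natFloor_mul_div_le hs0).trans hsI.2⟩
    have h1 := (hG s hsI).comp (tendsto_id.prodMk (tendsto_nhdsWithin_iff.2
        ⟨tendsto_natFloor_mul_div hτ hs0, Eventually.of_forall hfl⟩))
    filter_upwards [h1.eventually_lt_const hs, hE, hpos] with j h2 h3 h4
    -- Rounding down keeps the grid point at most `s`, so it bounds the hitting time by `s < a`;
    -- monotonicity of the floor keeps it at or after the starting index.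
    have h5 : ⌊(τ j : ℝ) * s⌋₊ ∈ E j := by
      rw [h3]
      refine ⟨Nat.floor_le_floor (by gcongr; exact hsI.1), ?_, h2⟩
      exact Nat.floor_le_of_le (by nlinarith [hsI.2, (Nat.cast_nonneg (τ j) : (0 : ℝ) ≤ τ j)])
    rw [sInf_image_natCast_div _ h4, if_pos ⟨_, h5⟩]
    refine lt_of_le_of_lt (EReal.coe_le_coe_iff.2 ?_) hsa
    refine le_trans ?_ (natFloor_mul_div_le (T := τ j) hs0)
    gcongr
    exact Nat.sInf_le h5

/-! ### Random families of quadratic functions rarely have infimum zero -/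

section Quadratic

variable {ι : Type*}

/-- The quadratic function with coefficients `(z i).1`, `(z i).2` and `q i`. -/
def quadFamily (q : ι → ℝ) (z : ι → ℝ × ℝ) (i : ι) (x : ℝ) : ℝ :=
  (z i).1 + x * (z i).2 + x ^ 2 * q i

/-- The pairs `(z, x)` for which all `quadFamily q z i` are nonnegative at `x` while in direction
`d` from `x`, up to the point `d * p`, the infimum over `i` decreases at least linearly. -/
def linearDecrease (q : ι → ℝ) (M : ℕ) (d : ℝ) (p e : ℚ) : Set ((ι → ℝ × ℝ) × ℝ) :=
  {y | (∀ i, |(y.1 i).1| ≤ M ∧ |(y.1 i).2| ≤ M) ∧ (∀ i, 0 ≤ quadFamily q y.1 i y.2) ∧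
    d * y.2 < p ∧ ∀ l : ℚ, d * y.2 < l → (l : ℝ) < p →
      ∃ i, quadFamily q y.1 i (d * l) < -(e * (l - d * y.2))}

theorem measurable_quadFamily (q : ι → ℝ) (i : ι) :
    Measurable fun y : (ι → ℝ × ℝ) × ℝ => quadFamily q y.1 i y.2 := by
  unfold quadFamily
  have h : Measurable fun y : (ι → ℝ × ℝ) × ℝ => y.1 i := (measurable_pi_apply i).comp measurable_fst
  exact (h.fst.add (measurable_snd.mul h.snd)).add ((measurable_snd.pow_const 2).mul_const _)

theorem measurableSet_linearDecrease [Countable ι] (q : ι → ℝ) (M : ℕ) (d : ℝ) (p e : ℚ) :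
    MeasurableSet (linearDecrease q M d p e) := by
  have hi : ∀ i, Measurable fun y : (ι → ℝ × ℝ) × ℝ => y.1 i := fun i =>
    (measurable_pi_apply i).comp measurable_fst
  have hd : Measurable fun y : (ι → ℝ × ℝ) × ℝ => d * y.2 := measurable_snd.const_mul d
  have hq : ∀ i (l : ℝ), Measurable fun y : (ι → ℝ × ℝ) × ℝ => quadFamily q y.1 i l := fun i l =>
    (measurable_quadFamily q i).comp (measurable_fst.prodMk measurable_const)
  have h1 : MeasurableSet {y : (ι → ℝ × ℝ) × ℝ | ∀ i, |(y.1 i).1| ≤ M ∧ |(y.1 i).2| ≤ M} := by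
    rw [ofPred_forall]
    refine MeasurableSet.iInter fun i => MeasurableSet.inter ?_ ?_
    · exact measurableSet_le (hi i).fst.norm measurable_const
    · exact measurableSet_le (hi i).snd.norm measurable_const
  have h2 : MeasurableSet {y : (ι → ℝ × ℝ) × ℝ | ∀ i, 0 ≤ quadFamily q y.1 i y.2} := by
    rw [ofPred_forall]
    exact MeasurableSet.iInter fun i => measurableSet_le measurable_const
      (measurable_quadFamily q i)
  have h3 : MeasurableSet {y : (ι → ℝ × ℝ) × ℝ | d * y.2 < p} :=
    measurableSet_lt hd measurable_const
  have h4 : MeasurableSet {y : (ι → ℝ × ℝ) × ℝ | ∀ l : ℚ, d * y.2 < l → (l : ℝ) < p →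
      ∃ i, quadFamily q y.1 i (d * l) < -(e * (l - d * y.2))} := by
    rw [ofPred_forall]
    refine MeasurableSet.iInter fun l => ?_
    have : {y : (ι → ℝ × ℝ) × ℝ | d * y.2 < l → (l : ℝ) < p →
        ∃ i, quadFamily q y.1 i (d * l) < -(e * (l - d * y.2))} =
        {y | d * y.2 < l}ᶜ ∪ ({y | (l : ℝ) < p}ᶜ ∪
          ⋃ i, {y | quadFamily q y.1 i (d * l) < -(e * (l - d * y.2))}) := by
      ext y
      simp only [mem_ofPred_eq, mem_union, mem_compl_iff, mem_iUnion]
      tauto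
    rw [this]
    refine (measurableSet_lt hd measurable_const).compl.union
      (MeasurableSet.union (by simp) (MeasurableSet.iUnion fun i => ?_))
    exact measurableSet_lt (hq i _) ((measurable_const.sub hd).const_mul _).neg
  exact h1.inter (h2.inter (h3.inter h4))

/-- If `x` came before `y` in direction `d`, the descent from `x` would put some quadratic below `-e
(d y - d x)` at points just beyond `y`. The common Lipschitz bound would then make that quadratic
negative at `y`. -/
theorem subsingleton_linearDecrease (q : ι → ℝ) {Q : ℝ} (hq : ∀ i, |q i| ≤ Q) (M : ℕ) {d : ℝ}
    (hd : d = 1 ∨ d = -1) (p : ℚ) {e : ℚ} (he : 0 < e) (z : ι → ℝ × ℝ) :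
    (Prod.mk z ⁻¹' linearDecrease q M d p e).Subsingleton := by
  have hdd : d * d = 1 := by rcases hd with rfl | rfl <;> norm_num
  have key : ∀ x y : ℝ, (z, x) ∈ linearDecrease q M d p e → (z, y) ∈ linearDecrease q M d p e →
      ¬ d * x < d * y := by
    rintro x y ⟨hz, -, -, hx⟩ ⟨-, hy, hyp, -⟩ hxy
    simp only at hz hx hy hyp
    have he' : (0 : ℝ) < e := by exact_mod_cast he
    -- On the unit interval beyond `d y` the quadratics have Lipschitz constant at most `M + Q (2 |d
    -- y| + 1)`. The extra `1` keeps the denominator positive.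
    obtain ⟨l, hl1, hl2⟩ : ∃ l : ℚ, (d * y < l) ∧ (l : ℝ) < min (p : ℝ) (d * y +
        min 1 (e * (d * y - d * x) / (M + Q * (2 * |d * y| + 1) + 1))) := by
      refine exists_rat_btwn (lt_min hyp ?_)
      have hQ : 0 ≤ Q := by
        by_cases hne : Nonempty ι
        · exact (abs_nonneg _).trans (hq hne.some)
        · obtain ⟨l, hl1, hl2⟩ := exists_rat_btwn (hxy.trans hyp)
          obtain ⟨i, -⟩ := hx l hl1 hl2
          exact absurd ⟨i⟩ hne
      have : 0 < e * (d * y - d * x) / (M + Q * (2 * |d * y| + 1) + 1) := by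
        apply div_pos (mul_pos he' (sub_pos.2 hxy)); positivity
      linarith [lt_min one_pos this]
    have hl3 : (l : ℝ) - d * y ≤ 1 := by
      have h1 := hl2.trans_le (min_le_right _ _)
      have h2 := min_le_left (1 : ℝ) (e * (d * y - d * x) / (M + Q * (2 * |d * y| + 1) + 1))
      linarith
    obtain ⟨i, hi⟩ := hx l (hxy.trans hl1) (hl2.trans_le (min_le_left _ _))
    have hyi := hy i
    have hQ : 0 ≤ Q := (abs_nonneg _).trans (hq i)
    have hl4 : ((l : ℝ) - d * y) * (M + Q * (2 * |d * y| + 1) + 1) ≤ e * (d * y - d * x) := by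
      have h1 := hl2.trans_le (min_le_right _ _)
      have h2 := min_le_right (1 : ℝ) (e * (d * y - d * x) / (M + Q * (2 * |d * y| + 1) + 1))
      rw [← le_div_iff₀ (by positivity)]
      linarith
    have hdiff : quadFamily q z i y - quadFamily q z i (d * l)
        = -(l - d * y) * (d * (z i).2 + (l + d * y) * q i) := by
      unfold quadFamily
      linear_combination (-(y * (z i).2 + y ^ 2 * q i + l ^ 2 * q i)) * hdd
    have hb : |d * (z i).2 + (l + d * y) * q i| ≤ M + Q * (2 * |d * y| + 1) := by
      refine (abs_add_le _ _).trans (add_le_add ?_ ?_)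
      · rw [abs_mul]
        have : |d| = 1 := by rcases hd with rfl | rfl <;> simp
        rw [this, one_mul]
        exact (hz i).2
      · rw [abs_mul, mul_comm]
        refine mul_le_mul (hq i) ?_ (abs_nonneg _) hQ
        have h1 : (l : ℝ) + d * y = 2 * (d * y) + (l - d * y) := by ring
        rw [h1]
        refine (abs_add_le _ _).trans (add_le_add ?_ ?_)
        · rw [abs_mul]; norm_num
        · rw [abs_of_nonneg (by linarith)]; exact hl3
    have h5 : 0 < (l : ℝ) - d * y := by linarith
    have h6 : -(l - d * y) * (d * (z i).2 + (l + d * y) * q i)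
        ≤ ((l : ℝ) - d * y) * (M + Q * (2 * |d * y| + 1)) := by
      have := (abs_le.1 hb).1
      nlinarith
    nlinarith
  intro x hx y hy
  rcases lt_trichotomy (d * x) (d * y) with h | h | h
  · exact absurd h (key x y hx hy)
  · calc x = d * d * x := by rw [hdd, one_mul]
      _ = d * d * y := by rw [mul_assoc, h, mul_assoc]
      _ = y := by rw [hdd, one_mul]
  · exact absurd h (key y x hy hx)

/-- By independence the joint law is a product, and each slice of `linearDecrease` has at most one
point, which the atomless law does not charge. Rational parameters and integer bounds leave a
countable union. -/
theorem ae_not_linear_decrease [Countable ι] {Ω : Type*} [MeasurableSpace Ω] {P : Measure Ω}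
    [IsProbabilityMeasure P] {ξ : Ω → ℝ} {Z : Ω → ι → ℝ × ℝ} (hξ : Measurable ξ)
    (hZ : Measurable Z) (hind : IndepFun Z ξ P) [NullSingletonClass (P.map ξ)] {q : ι → ℝ} {Q : ℝ}
    (hq : ∀ i, |q i| ≤ Q) :
    ∀ᵐ ω ∂P, (∃ M : ℝ, ∀ i, |(Z ω i).1| ≤ M ∧ |(Z ω i).2| ≤ M) →
      (∀ i, 0 ≤ quadFamily q (Z ω) i (ξ ω)) → ∀ d : ℝ, (d = 1 ∨ d = -1) → ∀ e > 0, ∀ δ > 0,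
      ¬ ∀ u ∈ Ioo 0 δ, ∃ i, quadFamily q (Z ω) i (ξ ω + d * u) < -(e * u) := by
  have hnull : ∀ (M : ℕ) (d : ℝ), (d = 1 ∨ d = -1) → ∀ (p e : ℚ), 0 < e →
      ∀ᵐ ω ∂P, (Z ω, ξ ω) ∉ linearDecrease q M d p e := by
    intro M d hd p e he
    have hlaw := (indepFun_iff_map_prod_eq_prod_map_map hZ.aemeasurable hξ.aemeasurable).1 hind
    have hms := measurableSet_linearDecrease q M d p e
    have h0 : (P.map fun ω => (Z ω, ξ ω)) (linearDecrease q M d p e) = 0 := by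
      have : IsProbabilityMeasure (P.map ξ) := Measure.isProbabilityMeasure_map hξ.aemeasurable
      have : IsProbabilityMeasure (P.map Z) := Measure.isProbabilityMeasure_map hZ.aemeasurable
      rw [hlaw, Measure.measure_prod_null hms]
      exact Eventually.of_forall fun z =>
        (subsingleton_linearDecrease q hq M hd p he z).measure_zero _
    rw [Measure.map_apply (hZ.prodMk hξ) hms] at h0
    exact measure_eq_zero_iff_ae_notMem.1 h0
  have hall : ∀ᵐ ω ∂P, ∀ (M : ℕ) (p e : ℚ), 0 < e →
      (Z ω, ξ ω) ∉ linearDecrease q M 1 p e ∧ (Z ω, ξ ω) ∉ linearDecrease q M (-1) p e := by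
    simp only [ae_all_iff]
    intro M p e he
    filter_upwards [hnull M 1 (Or.inl rfl) p e he, hnull M (-1) (Or.inr rfl) p e he] with ω h1 h2
    exact ⟨h1, h2⟩
  filter_upwards [hall] with ω hω
  rintro ⟨M, hM⟩ hnn d hd e he δ hδ hcon
  have hdd : d * d = 1 := by rcases hd with rfl | rfl <;> norm_num
  obtain ⟨e', he'0, he'⟩ := exists_rat_btwn he
  obtain ⟨p, hp1, hp2⟩ := exists_rat_btwn (show d * ξ ω < d * ξ ω + δ by linarith)
  obtain ⟨N, hN⟩ := exists_nat_ge M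
  have hmem : (Z ω, ξ ω) ∈ linearDecrease q N d p e' := by
    refine ⟨fun i => ⟨(hM i).1.trans hN, (hM i).2.trans hN⟩, hnn, hp1, fun l hl1 hl2 => ?_⟩
    simp only at hl1 ⊢
    obtain ⟨i, hi⟩ := hcon (l - d * ξ ω) ⟨by linarith, by linarith⟩
    refine ⟨i, ?_⟩
    have e1 : ξ ω + d * ((l : ℝ) - d * ξ ω) = d * l := by linear_combination (- ξ ω) * hdd
    rw [e1] at hi
    nlinarith
  have h := hω N p e' (by exact_mod_cast he'0)
  rcases hd with rfl | rfl
  · exact h.1 hmem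
  · exact h.2 hmem

end Quadratic

/-- If `ξ` has no atoms and is independent of the random functions `A` and `C`, then almost surely
the derivative of `x ↦ A s + x C s + x² q s` at `ξ` vanishes at every zero `s` of the
function `A + ξ C + ξ² q` when this function is nonnegative. -/
theorem ae_derivative_eq_zero_of_touching {Ω : Type*} [MeasurableSpace Ω] {P : Measure Ω}
    [IsProbabilityMeasure P] {ξ : Ω → ℝ} {a b : ℝ} {A C : ℝ → Ω → ℝ} {q : ℝ → ℝ} (hab : a ≤ b)
    (hξ : Measurable ξ) (hA : ∀ s, Measurable (A s)) (hC : ∀ s, Measurable (C s))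
    (hAc : ∀ ω, ContinuousOn (A · ω) (Icc a b)) (hCc : ∀ ω, ContinuousOn (C · ω) (Icc a b))
    (hq : ContinuousOn q (Icc a b)) [NullSingletonClass (P.map ξ)]
    (hind : ∀ s : ℕ → ℝ, IndepFun (fun ω i => (A (s i) ω, C (s i) ω)) ξ P) :
    ∀ᵐ ω ∂P, (∀ s ∈ Icc a b, 0 ≤ A s ω + ξ ω * C s ω + ξ ω ^ 2 * q s) →
      ∀ s ∈ Icc a b, A s ω + ξ ω * C s ω + ξ ω ^ 2 * q s = 0 → C s ω + 2 * ξ ω * q s = 0 := by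
  have : Nonempty (Icc a b) := ⟨⟨a, left_mem_Icc.2 hab⟩⟩
  -- A dense sequence of times gives a countable family, for which measurability is available;
  -- continuity in time transfers strict inequalities back to it.
  set D : ℕ → Icc a b := TopologicalSpace.denseSeq (Icc a b) with hD
  have hDr : DenseRange D := TopologicalSpace.denseRange_denseSeq _
  obtain ⟨Q, hQ⟩ := (isCompact_Icc.image_of_continuousOn hq).isBounded.exists_norm_le
  have h := ae_not_linear_decrease hξ (Z := fun ω i => (A (D i) ω, C (D i) ω))
    (measurable_pi_iff.2 fun i => (hA _).prodMk (hC _)) (hind fun i => D i)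
    (q := fun i => q (D i)) (Q := Q) (fun i => hQ _ ⟨D i, (D i).2, rfl⟩)
  filter_upwards [h] with ω hω hnn s hs hs0
  by_contra hne
  obtain ⟨M₁, hM₁⟩ := (isCompact_Icc.image_of_continuousOn (hAc ω)).isBounded.exists_norm_le
  obtain ⟨M₂, hM₂⟩ := (isCompact_Icc.image_of_continuousOn (hCc ω)).isBounded.exists_norm_le
  set v := C s ω + 2 * ξ ω * q s with hv
  have hv0 : 0 < |v| := abs_pos.2 hne
  obtain ⟨d, hd, hdv⟩ : ∃ d : ℝ, (d = 1 ∨ d = -1) ∧ d * v = -|v| := by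
    rcases lt_or_gt_of_ne hne with h | h
    · exact ⟨1, Or.inl rfl, by rw [abs_of_neg h]; ring⟩
    · exact ⟨-1, Or.inr rfl, by rw [abs_of_pos h]; ring⟩
  have hdd : d * d = 1 := by rcases hd with rfl | rfl <;> norm_num
  -- Moving `ξ` by `d u` changes the vanishing quadratic at `s` to `-|v| u + u² q s`, which is below
  -- `-(|v|/2) u` for `u` in the chosen range.
  refine hω ⟨max M₁ M₂, fun i => ⟨(hM₁ _ ⟨D i, (D i).2, rfl⟩).trans (le_max_left _ _),
    (hM₂ _ ⟨D i, (D i).2, rfl⟩).trans (le_max_right _ _)⟩⟩ (fun i => hnn _ (D i).2) d hd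
    (|v| / 2) (by positivity) (|v| / (2 * (|q s| + 1))) (by positivity) ?_
  intro u hu
  have hu2 : u * (|q s| + 1) < |v| / 2 := by
    have := hu.2
    rw [lt_div_iff₀ (by positivity)] at this
    linarith
  set x := ξ ω + d * u with hx
  have hneg : A s ω + x * C s ω + x ^ 2 * q s < -(|v| / 2 * u) := by
    have e1 : A s ω + x * C s ω + x ^ 2 * q s = u * (d * v) + u ^ 2 * q s := by
      rw [hx, hv]
      linear_combination hs0 + u ^ 2 * q s * hdd
    rw [e1, hdv]
    have h1 := le_abs_self (q s)
    have h2 : u * q s < |v| / 2 := by nlinarith [hu.1]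
    nlinarith [hu.1]
  have hcont : Continuous fun t : Icc a b => A t ω + x * C t ω + x ^ 2 * q t := by
    have h1 := continuousOn_iff_continuous_domRestrict.1 (hAc ω)
    have h2 := continuousOn_iff_continuous_domRestrict.1 (hCc ω)
    have h3 := continuousOn_iff_continuous_domRestrict.1 hq
    exact (h1.add (h2.const_mul x)).add (h3.const_mul (x ^ 2))
  obtain ⟨i, hi⟩ := hDr.exists_mem_open (isOpen_Iio.preimage hcont) ⟨⟨s, hs⟩, hneg⟩
  exact ⟨i, hi⟩

/-! ### The crossing functional of continuous paths -/

/-- With equal arguments the functional is integration against a point mass at `s` plus a density,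
hence linear in the path. -/
theorem crossing_self_eq {K : ℝ → ℝ} (hK : ContDiff ℝ 2 K) (z c : ℝ) {U : ℝ → ℝ}
    (hU : Continuous U) (s : ℝ) : crossing K z c U U s
      = K 0 * U s + ∫ r in (0 : ℝ)..s, U r * (z * deriv K (z * (s - r)) - 2 * c / s) := by
  have hc : Continuous (deriv K) := hK.continuous_deriv (by norm_num)
  rw [crossing, kernelFunctional, ← intervalIntegral.integral_const_mul, add_sub_assoc,
    ← intervalIntegral.integral_sub (Continuous.intervalIntegrable (by fun_prop) _ _)
      (Continuous.intervalIntegrable (by fun_prop) _ _)]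
  congr 2
  ext r
  ring

theorem crossing_self_add_mul {K : ℝ → ℝ} (hK : ContDiff ℝ 2 K) (z c : ℝ) {U V : ℝ → ℝ}
    (hU : Continuous U) (hV : Continuous V) (a s : ℝ) :
    crossing K z c (fun r => U r + a * V r) (fun r => U r + a * V r) s
      = crossing K z c U U s + a * crossing K z c V V s := by
  have hc : Continuous (deriv K) := hK.continuous_deriv (by norm_num)
  rw [crossing_self_eq hK z c hU, crossing_self_eq hK z c hV, crossing_self_eq hK z c (by fun_prop),
    mul_add a, ← intervalIntegral.integral_const_mul, add_add_add_comm,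
    ← intervalIntegral.integral_add (Continuous.intervalIntegrable (by fun_prop) _ _)
      (Continuous.intervalIntegrable (by fun_prop) _ _)]
  congr 1
  · ring
  · congr 1
    ext r
    ring

/-- The fundamental theorem of calculus for `r ↦ r K(z (s - r))`. It identifies the contribution of
the drift of `∑ ε²`. -/
theorem kernelFunctional_id {K : ℝ → ℝ} (hK : ContDiff ℝ 2 K) (z s : ℝ) :
    kernelFunctional K z (fun r => r) s = ∫ r in (0 : ℝ)..s, K (z * (s - r)) := by
  have hc : Continuous (deriv K) := hK.continuous_deriv (by norm_num)
  have hc0 : Continuous K := hK.continuous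
  have hd : ∀ r : ℝ, HasDerivAt (fun r => r * K (z * (s - r)))
      (K (z * (s - r)) - r * (z * deriv K (z * (s - r)))) r := by
    intro r
    have h1 : HasDerivAt (fun r : ℝ => z * (s - r)) (-z) r := by
      simpa using ((hasDerivAt_id r).const_sub s).const_mul z
    have h2 : HasDerivAt K (deriv K (z * (s - r))) (z * (s - r)) :=
      ((hK.differentiable (by norm_num)) _).hasDerivAt
    have h3 : HasDerivAt (fun r => r * K (z * (s - r)))
      (1 * K (z * (s - r)) + r * (deriv K (z * (s - r)) * -z)) r :=
      (hasDerivAt_id r).mul (h2.comp r h1)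
    exact h3.congr_deriv (by ring)
  have h := intervalIntegral.integral_eq_sub_of_hasDerivAt (a := 0) (b := s) (fun r _ => hd r)
    (Continuous.intervalIntegrable (by fun_prop) _ _)
  rw [intervalIntegral.integral_sub (Continuous.intervalIntegrable (by fun_prop) _ _)
    (Continuous.intervalIntegrable (by fun_prop) _ _)] at h
  simp only [sub_self, mul_zero, zero_mul, sub_zero] at h
  rw [kernelFunctional]
  linarith

theorem crossing_compensated {K : ℝ → ℝ} (hK : ContDiff ℝ 2 K) (z c : ℝ) {f : ℝ → ℝ}
    (hf : Continuous f) (η v s : ℝ) :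
    crossing K z c (fun r => (η * f r) ^ 2 - v * r) (fun r => (η * f r) ^ 2) s
      = η ^ 2 * crossing K z c (fun r => f r ^ 2) (fun r => f r ^ 2) s
        - v * ∫ r in (0 : ℝ)..s, K (z * (s - r)) := by
  have hc : Continuous (deriv K) := hK.continuous_deriv (by norm_num)
  rw [← kernelFunctional_id hK]
  simp only [crossing, kernelFunctional, mul_pow, sub_mul, mul_assoc,
    intervalIntegral.integral_const_mul]
  rw [intervalIntegral.integral_sub (Continuous.intervalIntegrable (by fun_prop) _ _)
      (Continuous.intervalIntegrable (by fun_prop) _ _)]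
  simp only [intervalIntegral.integral_const_mul]
  ring

theorem continuousOn_crossing {K : ℝ → ℝ} (hK : ContDiff ℝ 2 K) (z c : ℝ) {U V : ℝ → ℝ}
    (hU : Continuous U) (hV : Continuous V) {a b : ℝ} (ha : 0 < a) (hb : b ≤ 1) :
    ContinuousOn (crossing K z c U V) (Icc a b) := by
  intro s hs
  have hc : ∀ W : ℝ → ℝ, TendstoUniformlyOn (fun _ : ℝ => W) W (𝓝[Icc a b] s) (Icc 0 1) := by
    intro W
    rw [Metric.tendstoUniformlyOn_iff]
    intro e he
    exact Eventually.of_forall fun _ x _ => by simpa using he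
  refine tendsto_crossing hK c (z := fun _ => z) (s := fun x => x) (hc U) (fun _ => hU.measurable)
    hU.continuousOn (hc V) (fun _ => hV.measurable) hV.continuousOn tendsto_const_nhds
    (tendsto_id.mono_left nhdsWithin_le_nhds) ?_ ⟨ha.trans_le hs.1, hs.2.trans hb⟩
  filter_upwards [self_mem_nhdsWithin] with x hx
  exact ⟨ha.le.trans hx.1, hx.2.trans hb⟩

theorem lt_iff_crossing_lt_zero {K : ℝ → ℝ} (hK : ContDiff ℝ 2 K) {z c : ℝ} {f : ℝ → ℝ}
    (hf : Continuous f) {η v s : ℝ} (hη : 0 < η) (hs : 0 < s)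
    (hI : 0 < ∫ r in (0 : ℝ)..s, f r ^ 2) :
    (s / 2 * (K 0 * f s ^ 2 + z * (∫ r in (0 : ℝ)..s, f r ^ 2 * deriv K (z * (s - r)))
      - v / η ^ 2 * (∫ r in (0 : ℝ)..s, K (z * (s - r))))) / (∫ r in (0 : ℝ)..s, f r ^ 2) < c ↔
    crossing K z c (fun r => (η * f r) ^ 2 - v * r) (fun r => (η * f r) ^ 2) s < 0 := by
  rw [crossing_compensated hK z c hf]
  simp only [crossing, kernelFunctional, mul_left_comm _ z, intervalIntegral.integral_const_mul]
  generalize (∫ r in (0 : ℝ)..s, f r ^ 2) = I at hI ⊢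
  generalize (∫ r in (0 : ℝ)..s, f r ^ 2 * deriv K (z * (s - r))) = J
  generalize (∫ r in (0 : ℝ)..s, K (z * (s - r))) = L
  rw [div_lt_iff₀ hI]
  have e1 : η ^ 2 * (K 0 * f s ^ 2 + z * J - 2 * c / s * I) - v * L
      = 2 * η ^ 2 / s * (s / 2 * (K 0 * f s ^ 2 + z * J - v / η ^ 2 * L) - c * I) := by
    field_simp
    ring
  rw [e1, mul_neg_iff]
  have e2 : 0 < 2 * η ^ 2 / s := by positivity
  constructor
  · intro h
    exact Or.inl ⟨e2, by linarith⟩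
  · rintro (h | h)
    · linarith [h.2]
    · linarith [h.1]

/-! ### Touching the boundary -/

theorem eq_zero_on_Ioo_of_rat {g : ℝ → ℝ} (hg : Continuous g) {s : ℝ}
    (h : ∀ t : ℚ, 0 < (t : ℝ) → (t : ℝ) < s → g t = 0) : ∀ t ∈ Ioo 0 s, g t = 0 := by
  intro t ht
  by_contra hne
  obtain ⟨q, hq1, hq2⟩ := Rat.denseRange_cast (𝕜 := ℝ).exists_mem_open
    ((isOpen_ne_fun hg continuous_const).inter isOpen_Ioo) ⟨t, hne, ht⟩
  exact hq1 (h q hq2.1 hq2.2)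

theorem HasDerivAt.eq_zero_of_zero_on_Ioo {g : ℝ → ℝ} {g' s t : ℝ} (hg : HasDerivAt g g' t)
    (h : ∀ t ∈ Ioo 0 s, g t = 0) (ht : t ∈ Ioo 0 s) : g' = 0 := by
  refine hg.unique ((hasDerivAt_const t (0 : ℝ)).congr_of_eventuallyEq ?_)
  filter_upwards [isOpen_Ioo.mem_nhds ht] with u hu
  exact h u hu

/-- The functions `r ↦ min r t` separate the measures `k δ_s + φ dr` on `[0, s]`. -/
theorem eq_zero_of_forall_integral_mul_min {φ : ℝ → ℝ} (hφ : Continuous φ) {k s : ℝ} (hs : 0 < s)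
    (h : ∀ t : ℚ, 0 < (t : ℝ) → (t : ℝ) < s →
      k * min s t + ∫ r in (0 : ℝ)..s, φ r * min r t = 0) :
    k = 0 ∧ ∀ r ∈ Ioo 0 s, φ r = 0 := by
  set I := ∫ r in (0 : ℝ)..s, φ r with hI
  set F : ℝ → ℝ := fun t => ∫ r in (0 : ℝ)..t, φ r with hF
  set F₁ : ℝ → ℝ := fun t => ∫ r in (0 : ℝ)..t, φ r * r with hF₁
  have hFd : ∀ t, HasDerivAt F (φ t) t := fun t =>
    intervalIntegral.integral_hasDerivAt_right (hφ.intervalIntegrable _ _)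
      hφ.stronglyMeasurable.stronglyMeasurableAtFilter hφ.continuousAt
  have hφ₁ : Continuous fun r => φ r * r := by fun_prop
  have hF₁d : ∀ t, HasDerivAt F₁ (φ t * t) t := fun t =>
    intervalIntegral.integral_hasDerivAt_right (hφ₁.intervalIntegrable _ _)
      hφ₁.stronglyMeasurable.stronglyMeasurableAtFilter hφ₁.continuousAt
  -- On `(0, s)` this is the hypothesis as a function of `t`. Its derivative is `k + ∫_t^s φ` and
  -- its second derivative is `-φ`, so both must vanish.
  set H : ℝ → ℝ := fun t => k * t + F₁ t + t * (I - F t) with hH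
  have hHd : ∀ t, HasDerivAt H (k + (I - F t)) t := by
    intro t
    have h1 := (((hasDerivAt_id t).const_mul k).add (hF₁d t)).add
      ((hasDerivAt_id t).mul ((hFd t).const_sub I))
    refine HasDerivAt.congr_deriv (f := H) h1 ?_
    simp only [id]
    ring
  have hH0 : ∀ t ∈ Ioo 0 s, H t = 0 := by
    refine eq_zero_on_Ioo_of_rat
      (continuous_iff_continuousAt.2 fun t => (hHd t).continuousAt) fun t ht0 hts => ?_
    have h1 := h t ht0 hts
    rw [min_eq_right hts.le, ← intervalIntegral.integral_add_adjacent_intervals (b := (t : ℝ))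
      (Continuous.intervalIntegrable (by fun_prop) _ _)
      (Continuous.intervalIntegrable (by fun_prop) _ _)] at h1
    have h2 : ∫ r in (0 : ℝ)..t, φ r * min r t = F₁ t := by
      refine intervalIntegral.integral_congr fun r hr => ?_
      rw [uIcc_of_le ht0.le] at hr
      simp only [min_eq_left hr.2]
    have h3 : ∫ r in (t : ℝ)..s, φ r * min r t = t * (I - F t) := by
      rw [hI, intervalIntegral.integral_interval_sub_left (hφ.intervalIntegrable _ _)
        (hφ.intervalIntegrable _ _), ← intervalIntegral.integral_const_mul]
      refine intervalIntegral.integral_congr fun r hr => ?_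
      rw [uIcc_of_le hts.le] at hr
      simp only [min_eq_right hr.1, mul_comm]
    rw [h2, h3] at h1
    simp only [hH]
    linarith
  have hH1 : ∀ t ∈ Ioo 0 s, k + (I - F t) = 0 := fun t ht =>
    HasDerivAt.eq_zero_of_zero_on_Ioo (hHd t) hH0 ht
  have hφ0 : ∀ t ∈ Ioo 0 s, φ t = 0 := by
    intro t ht
    have h1 := HasDerivAt.eq_zero_of_zero_on_Ioo (((hFd t).const_sub I).const_add k) hH1 ht
    linarith
  refine ⟨?_, hφ0⟩
  have hI0 : I = 0 := by
    rw [hI, intervalIntegral.integral_congr_Ioo_of_le hs.le (g := fun _ => 0) hφ0]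
    simp
  have hF0 : F (s / 2) = 0 := by
    simp only [hF]
    rw [intervalIntegral.integral_congr_Ioo_of_le (by linarith) (g := fun _ => 0)
      fun r hr => hφ0 r ⟨hr.1, by linarith [hr.2]⟩]
    simp
  have := hH1 (s / 2) ⟨by linarith, by linarith⟩
  rw [hI0, hF0] at this
  linarith

/-- The hypothesis kills the endpoint mass and the density, hence the whole quadratic part. Only `-v
∫ K` remains; if it vanished too, `K` and `K'` would be zero at `z (s - r)`, and the density would
reduce to `-(2c/s) f r`, nonzero for a suitable `r`. -/
theorem crossing_ne_zero_of_forall_crossing_mul_min {K : ℝ → ℝ} (hK : ContDiff ℝ 2 K)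
    (hK0 : ∀ x, 0 ≤ K x) {z c : ℝ} (hc : c < 0) {f : ℝ → ℝ} (hf : Continuous f) {η v s : ℝ}
    (hv : 0 < v) (hs : 0 < s)
    (h : ∀ t : ℚ, 0 < (t : ℝ) → (t : ℝ) < s →
      crossing K z c (fun r => f r * min r t) (fun r => f r * min r t) s = 0)
    (hf0 : ∃ r ∈ Ioo 0 s, f r ≠ 0) :
    crossing K z c (fun r => (η * f r) ^ 2 - v * r) (fun r => (η * f r) ^ 2) s ≠ 0 := by
  have hKd : Continuous (deriv K) := hK.continuous_deriv (by norm_num)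
  have hKc : Continuous K := hK.continuous
  obtain ⟨hk, hφ⟩ := eq_zero_of_forall_integral_mul_min
    (φ := fun r => f r * (z * deriv K (z * (s - r)) - 2 * c / s)) (by fun_prop) (k := K 0 * f s) hs
    (by
      intro t ht0 hts
      have h1 := h t ht0 hts
      rw [crossing_self_eq hK z c (by fun_prop)] at h1
      refine Eq.trans ?_ h1
      congr 1
      · ring
      · congr 1
        ext r
        ring)
  have hQ : crossing K z c (fun r => f r ^ 2) (fun r => f r ^ 2) s = 0 := by
    rw [crossing_self_eq hK z c (by fun_prop),
      intervalIntegral.integral_congr_Ioo_of_le hs.le (g := fun _ => 0)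
        (fun r hr => by simp only [pow_two, mul_assoc, hφ r hr, mul_zero])]
    simp only [pow_two, ← mul_assoc, hk]
    simp
  rw [crossing_compensated hK z c hf, hQ]
  intro h0
  have hg : ∫ r in (0 : ℝ)..s, K (z * (s - r)) = 0 := by
    rcases mul_eq_zero.1 (show v * ∫ r in (0 : ℝ)..s, K (z * (s - r)) = 0 by linarith) with h1 | h1
    · exact absurd h1 hv.ne'
    · exact h1
  obtain ⟨r, hr, hfr⟩ := hf0
  have hKr : K (z * (s - r)) = 0 := by
    by_contra hne
    exact absurd hg (ne_of_gt (intervalIntegral.integral_pos hs (by fun_prop)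
      (fun x _ => hK0 _) ⟨r, Ioo_subset_Icc_self hr, lt_of_le_of_ne (hK0 _) (Ne.symm hne)⟩))
  -- A zero of the nonnegative function `K` is a global minimum.
  have hdr : deriv K (z * (s - r)) = 0 := by
    refine IsLocalMin.deriv_eq_zero (Eventually.of_forall fun x => ?_)
    rw [hKr]
    exact hK0 x
  have h1 := hφ r hr
  simp only [hdr, mul_zero, zero_sub, mul_eq_zero, hfr, neg_eq_zero, div_eq_zero_iff, false_or] at h1
  rcases h1 with (h1 | h1) | h1 <;> linarith

section

/-! ### Brownian paths do not touch the boundary without crossing it -/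

theorem measurable_intervalIntegral_of_continuous {Ω : Type*} {m : MeasurableSpace Ω}
    {u : ℝ → Ω → ℝ} (hu : ∀ ω, Continuous (u · ω)) (hum : ∀ r, Measurable (u r)) (a b : ℝ) :
    Measurable fun ω => ∫ r in a..b, u r ω := by
  have h : StronglyMeasurable (Function.uncurry u) :=
    (measurable_uncurry_of_continuous_of_measurable hu hum).stronglyMeasurable
  exact ((h.integral_prod_left' (μ := volume.restrict (Ioc a b))).sub
    (h.integral_prod_left' (μ := volume.restrict (Ioc b a)))).measurable

theorem measurable_crossing {Ω : Type*} {m : MeasurableSpace Ω} {K : ℝ → ℝ}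
    (hK : ContDiff ℝ 2 K) (z c : ℝ) {u v : ℝ → Ω → ℝ} (hu : ∀ ω, Continuous (u · ω))
    (hum : ∀ r, Measurable (u r)) (hv : ∀ ω, Continuous (v · ω)) (hvm : ∀ r, Measurable (v r))
    (s : ℝ) : Measurable fun ω => crossing K z c (u · ω) (v · ω) s := by
  have hc : Continuous (deriv K) := hK.continuous_deriv (by norm_num)
  have h1 : Measurable fun ω => ∫ r in (0 : ℝ)..s, u r ω * (z * deriv K (z * (s - r))) :=
    measurable_intervalIntegral_of_continuous (u := fun r ω => u r ω * (z * deriv K (z * (s - r))))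
      (fun ω => (hu ω).mul (by fun_prop)) (fun r => (hum r).mul_const _) 0 s
  have h2 : Measurable fun ω => ∫ r in (0 : ℝ)..s, v r ω :=
    measurable_intervalIntegral_of_continuous hv hvm 0 s
  exact (((hum s).const_mul _).add h1).sub (h2.const_mul _)

theorem crossing_congr {K : ℝ → ℝ} {z c s : ℝ} (hs : 0 ≤ s) {U U' V V' : ℝ → ℝ}
    (hU : EqOn U U' (Icc 0 s)) (hV : EqOn V V' (Icc 0 s)) :
    crossing K z c U V s = crossing K z c U' V' s := by
  have h1 : ∫ r in (0 : ℝ)..s, U r * (z * deriv K (z * (s - r)))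
      = ∫ r in (0 : ℝ)..s, U' r * (z * deriv K (z * (s - r))) :=
    intervalIntegral.integral_congr fun r hr => by
      rw [uIcc_of_le hs] at hr
      simp only [hU hr]
  have h2 : ∫ r in (0 : ℝ)..s, V r = ∫ r in (0 : ℝ)..s, V' r :=
    intervalIntegral.integral_congr fun r hr => by
      rw [uIcc_of_le hs] at hr
      exact hV hr
  rw [crossing, crossing, kernelFunctional, kernelFunctional, h1, h2, hU (right_mem_Icc.2 hs)]

theorem crossing_self_const_mul {K : ℝ → ℝ} (hK : ContDiff ℝ 2 K) (z c : ℝ) {V : ℝ → ℝ}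
    (hV : Continuous V) (a s : ℝ) :
    crossing K z c (fun r => a * V r) (fun r => a * V r) s = a * crossing K z c V V s := by
  have h := crossing_self_add_mul hK z c (U := fun _ => 0) continuous_const hV a s
  have h0 : crossing K z c (fun _ => 0) (fun _ => 0) s = 0 := by simp [crossing, kernelFunctional]
  simpa [h0] using h

variable {Ω : Type*} [MeasurableSpace Ω] {P : Measure Ω} {B : ℝ≥0 → Ω → ℝ}

/-- The function `r ↦ min r t / t`, the regression coefficient of `B r` on `B t`. -/
def bridgeCoeff (t : ℝ≥0) (r : ℝ) : ℝ := (min r.toNNReal t : ℝ≥0) / t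

/-- The part of `B r` that is independent of `B t`. -/
def bridge (B : ℝ≥0 → Ω → ℝ) (t : ℝ≥0) (r : ℝ) (ω : Ω) : ℝ :=
  B r.toNNReal ω - bridgeCoeff t r * B t ω

theorem continuous_bridgeCoeff (t : ℝ≥0) : Continuous (bridgeCoeff t) := by
  unfold bridgeCoeff
  have : Continuous fun r : ℝ => ((min r.toNNReal t : ℝ≥0) : ℝ) :=
    NNReal.continuous_coe.comp (continuous_real_toNNReal.min continuous_const)
  exact this.div_const _

/-- The bridge and `B t` are jointly Gaussian, so vanishing covariance suffices: `min r t - (min r t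
/ t) t = 0`. -/
theorem indepFun_bridge (hB : IsPreBrownianReal B P) (hm : ∀ t, Measurable (B t)) {t : ℝ≥0}
    (ht : 0 < t) : IndepFun (fun ω r => bridge B t r ω) (B t) P := by
  have := hB.isGaussianProcess.isProbabilityMeasure
  have hbm : ∀ r, Measurable (bridge B t r) := fun r => (hm _).sub ((hm t).const_mul _)
  have h : IndepFun (fun ω r => bridge B t r ω) (fun ω (_ : Unit) => B t ω) P := by
    refine IsGaussianProcess.indepFun_of_covariance_eq_zero (X := bridge B t)
      (Y := fun _ : Unit => B t) ?_ (fun r => (hbm r).aemeasurable)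
      (fun _ => (hm t).aemeasurable) ?_
    · classical
      apply hB.isGaussianProcess.of_isGaussianProcess
      rintro (r | _)
      · exact ⟨{r.toNNReal, t},
          { toFun x := x ⟨r.toNNReal, by simp⟩ - bridgeCoeff t r * x ⟨t, by simp⟩
            map_add' x y := by simp; ring
            map_smul' c x := by simp; ring }, by simp [bridge]⟩
      · exact ⟨{t},
          { toFun x := x ⟨t, by simp⟩
            map_add' x y := by simp
            map_smul' c x := by simp }, by simp⟩
    · intro r _
      have h2 : ∀ s, MemLp (B s) 2 P := fun s => (hB.isGaussianProcess.hasGaussianLaw_eval s).memLp_two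
      change cov[fun ω => B r.toNNReal ω - bridgeCoeff t r * B t ω, B t; P] = 0
      rw [covariance_fun_sub_left (h2 _) ((h2 t).const_mul _) (h2 t), covariance_const_mul_left,
        hB.covariance_eval, hB.covariance_eval, min_self, bridgeCoeff]
      have : (t : ℝ) ≠ 0 := by exact_mod_cast ht.ne'
      field_simp
      simp
  exact h.comp measurable_id (measurable_pi_apply ())

/-- The functional is quadratic in `B t`, with random coefficients determined by the bridge. Up to
the factor `2 η² / t`, its derivative in `B t` is the functional of `r ↦ B r * min r t`. -/
theorem ae_crossing_mul_min_eq_zero (hB : IsPreBrownianReal B P) (hm : ∀ t, Measurable (B t))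
    (hc : ∀ ω, Continuous (B · ω)) {K : ℝ → ℝ} (hK : ContDiff ℝ 2 K) (z c v : ℝ) {η : ℝ}
    (hη : 0 < η) {κ x : ℝ} (hκ : 0 < κ) (hκx : κ ≤ x) (hx : x ≤ 1) {t : ℝ} (ht : 0 < t) :
    ∀ᵐ ω ∂P, (∀ s ∈ Icc κ x, 0 ≤ crossing K z c (fun r => (η * B r.toNNReal ω) ^ 2 - v * r)
        (fun r => (η * B r.toNNReal ω) ^ 2) s) →
      ∀ s ∈ Icc κ x, crossing K z c (fun r => (η * B r.toNNReal ω) ^ 2 - v * r)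
        (fun r => (η * B r.toNNReal ω) ^ 2) s = 0 →
      crossing K z c (fun r => B r.toNNReal ω * min r t) (fun r => B r.toNNReal ω * min r t) s
        = 0 := by
  have := hB.isGaussianProcess.isProbabilityMeasure
  set t' : ℝ≥0 := t.toNNReal with ht'
  have ht'0 : 0 < t' := Real.toNNReal_pos.2 ht
  set e := bridgeCoeff t' with he
  have hec : Continuous e := continuous_bridgeCoeff t'
  have hBc : ∀ ω, Continuous fun r : ℝ => B r.toNNReal ω := fun ω =>
    (hc ω).comp continuous_real_toNNReal
  have hbc : ∀ ω, Continuous fun r : ℝ => bridge B t' r ω := fun ω =>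
    (hBc ω).sub (hec.mul_const _)
  have hbm : ∀ r, Measurable (bridge B t' r) := fun r => (hm _).sub ((hm t').const_mul _)
  set A : ℝ → Ω → ℝ := fun s ω => crossing K z c (fun r => (η * bridge B t' r ω) ^ 2 - v * r)
    (fun r => (η * bridge B t' r ω) ^ 2) s with hA
  set C : ℝ → Ω → ℝ := fun s ω => 2 * η ^ 2 * crossing K z c (fun r => bridge B t' r ω * e r)
    (fun r => bridge B t' r ω * e r) s with hC
  set q : ℝ → ℝ := fun s => η ^ 2 * crossing K z c (fun r => e r ^ 2) (fun r => e r ^ 2) s with hq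
  -- The σ-algebra is left arbitrary: the ambient one gives measurability, the one generated by the
  -- bridge gives independence from `B t`.
  have hAm : ∀ {m : MeasurableSpace Ω}, (∀ r, Measurable (bridge B t' r)) → ∀ s, Measurable (A s) :=
    fun h s => measurable_crossing hK z c (fun ω => by have := hbc ω; fun_prop)
      (fun r => (((h r).const_mul η).pow_const 2).sub_const _)
      (fun ω => by have := hbc ω; fun_prop) (fun r => ((h r).const_mul η).pow_const 2) s
  have hCm : ∀ {m : MeasurableSpace Ω}, (∀ r, Measurable (bridge B t' r)) → ∀ s, Measurable (C s) :=
    fun h s => (measurable_crossing hK z c (fun ω => (hbc ω).mul hec)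
      (fun r => (h r).mul_const _) (fun ω => (hbc ω).mul hec) (fun r => (h r).mul_const _)
      s).const_mul _
  have hlaw : P.map (B t') = gaussianReal 0 t' := (hB.hasLaw_eval t').map_eq
  have hna : NullSingletonClass (P.map (B t')) := by
    rw [hlaw]
    exact nullSingletonClass_gaussianReal ht'0.ne'
  have key := ae_derivative_eq_zero_of_touching (P := P) (ξ := B t') (A := A) (C := C) (q := q) hκx
    (hm t') (hAm hbm) (hCm hbm)
    (fun ω => continuousOn_crossing hK z c (by have := hbc ω; fun_prop)
      (by have := hbc ω; fun_prop) hκ hx)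
    (fun ω => (continuousOn_crossing hK z c ((hbc ω).mul hec) ((hbc ω).mul hec) hκ hx).const_mul _)
    ((continuousOn_crossing hK z c (hec.pow 2) (hec.pow 2) hκ hx).const_mul _)
    (by
      intro s
      have hind := (IndepFun_iff_Indep _ _ _).1 (indepFun_bridge hB hm ht'0)
      rw [IndepFun_iff_Indep]
      refine indep_of_indep_of_le_left hind (Measurable.comap_le ?_)
      have h1 : ∀ r, Measurable[MeasurableSpace.comap (fun ω r => bridge B t' r ω) inferInstance]
          (bridge B t' r) := fun r =>
        (measurable_pi_apply r).comp (comap_measurable (fun ω r => bridge B t' r ω))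
      exact (@measurable_pi_iff _ _ _ (MeasurableSpace.comap (fun ω r => bridge B t' r ω)
        MeasurableSpace.pi) _ _).2 fun i => (hAm h1 _).prodMk (hCm h1 _))
  have hexp : ∀ ω s, crossing K z c (fun r => (η * B r.toNNReal ω) ^ 2 - v * r)
      (fun r => (η * B r.toNNReal ω) ^ 2) s = A s ω + B t' ω * C s ω + B t' ω ^ 2 * q s := by
    intro ω s
    have hb := hbc ω
    have h1 : (fun r : ℝ => B r.toNNReal ω ^ 2) = fun r => (bridge B t' r ω ^ 2 +
        (2 * B t' ω) * (bridge B t' r ω * e r)) + B t' ω ^ 2 * e r ^ 2 := by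
      ext r
      simp only [bridge, ← he]
      ring
    simp only [hA]
    rw [crossing_compensated hK z c (hBc ω), crossing_compensated hK z c (hbc ω), h1,
      crossing_self_add_mul hK z c (by fun_prop) (by fun_prop),
      crossing_self_add_mul hK z c (by fun_prop) (by fun_prop)]
    simp only [hC, hq]
    ring
  have hder : ∀ ω, ∀ s ∈ Icc κ x, C s ω + 2 * B t' ω * q s = 2 * η ^ 2 * (t⁻¹ *
      crossing K z c (fun r => B r.toNNReal ω * min r t) (fun r => B r.toNNReal ω * min r t) s) := by
    intro ω s hs
    have hb := hbc ω
    have hb' := hBc ω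
    have h1 : EqOn (fun r : ℝ => t⁻¹ * (B r.toNNReal ω * min r t))
        (fun r => bridge B t' r ω * e r + B t' ω * e r ^ 2) (Icc 0 s) := by
      intro r hr
      have h2 : e r = t⁻¹ * min r t := by
        rw [he, bridgeCoeff, NNReal.coe_min, Real.coe_toNNReal _ hr.1, ht',
          Real.coe_toNNReal _ ht.le]
        ring
      simp only [bridge, ← he, h2]
      ring
    rw [← crossing_self_const_mul hK z c (by fun_prop), crossing_congr (hκ.le.trans hs.1) h1 h1,
      crossing_self_add_mul hK z c (by fun_prop) (by fun_prop)]
    simp only [hC, hq]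
    ring
  filter_upwards [key] with ω hω hnn s hs hs0
  have h1 := hω (fun s hs => by rw [← hexp]; exact hnn s hs) s hs (by rw [← hexp]; exact hs0)
  rw [hder ω s hs] at h1
  have h2 : (2 * η ^ 2) * t⁻¹ ≠ 0 := by positivity
  rw [← mul_assoc] at h1
  exact (mul_eq_zero.1 h1).resolve_left h2

theorem ae_ne_zero (hB : IsPreBrownianReal B P) {t : ℝ≥0} (ht : 0 < t) :
    ∀ᵐ ω ∂P, B t ω ≠ 0 := by
  have h := hB.hasLaw_eval t
  have hna : NullSingletonClass (gaussianReal 0 t) := nullSingletonClass_gaussianReal ht.ne'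
  have h0 : P.map (B t) {0} = 0 := by rw [h.map_eq]; exact measure_singleton 0
  rw [Measure.map_apply_of_aemeasurable h.aemeasurable (measurableSet_singleton 0)] at h0
  exact measure_eq_zero_iff_ae_notMem.1 h0

theorem ae_crossing_pos (hB : IsPreBrownianReal B P) (hm : ∀ t, Measurable (B t))
    (hc : ∀ ω, Continuous (B · ω)) {K : ℝ → ℝ} (hK : ContDiff ℝ 2 K) (hK0 : ∀ x, 0 ≤ K x)
    (z : ℝ) {c v η : ℝ} (hc0 : c < 0) (hv : 0 < v) (hη : 0 < η) {κ x : ℝ} (hκ : 0 < κ)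
    (hκx : κ ≤ x) (hx : x ≤ 1) :
    ∀ᵐ ω ∂P, (∀ s ∈ Icc κ x, 0 ≤ crossing K z c (fun r => (η * B r.toNNReal ω) ^ 2 - v * r)
        (fun r => (η * B r.toNNReal ω) ^ 2) s) →
      ∀ s ∈ Icc κ x, 0 < crossing K z c (fun r => (η * B r.toNNReal ω) ^ 2 - v * r)
        (fun r => (η * B r.toNNReal ω) ^ 2) s := by
  have h1 : ∀ᵐ ω ∂P, ∀ t : ℚ, 0 < (t : ℝ) →
      (∀ s ∈ Icc κ x, 0 ≤ crossing K z c (fun r => (η * B r.toNNReal ω) ^ 2 - v * r)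
        (fun r => (η * B r.toNNReal ω) ^ 2) s) →
      ∀ s ∈ Icc κ x, crossing K z c (fun r => (η * B r.toNNReal ω) ^ 2 - v * r)
        (fun r => (η * B r.toNNReal ω) ^ 2) s = 0 →
      crossing K z c (fun r => B r.toNNReal ω * min r t) (fun r => B r.toNNReal ω * min r t) s
        = 0 := by
    simp only [ae_all_iff]
    exact fun t ht => ae_crossing_mul_min_eq_zero hB hm hc hK z c v hη hκ hκx hx ht
  -- The time `κ / 2` lies in `(0, s)` for every `s ≥ κ`, so one null set serves all touching times.
  have hκ2 : 0 < (κ / 2).toNNReal := Real.toNNReal_pos.2 (by linarith)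
  filter_upwards [h1, ae_ne_zero hB hκ2] with ω h1 h2 hnn s hs
  refine lt_of_le_of_ne (hnn s hs) fun h0 => ?_
  refine crossing_ne_zero_of_forall_crossing_mul_min hK hK0 (z := z) hc0
    ((hc ω).comp continuous_real_toNNReal) (η := η) hv (hκ.trans_le hs.1)
    (fun t ht _ => h1 t ht hnn s hs h0.symm) ⟨κ / 2, ⟨by linarith, by linarith [hs.1]⟩, h2⟩ h0.symm

/-- A Brownian motion is indistinguishable from a measurable process with continuous paths. -/
theorem exists_continuous_measurable_version (hB : IsBrownianReal B P) :
    ∃ C : ℝ≥0 → Ω → ℝ, (∀ t, Measurable (C t)) ∧ (∀ ω, Continuous (C · ω)) ∧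
      ∀ᵐ ω ∂P, ∀ t, B t ω = C t ω := by
  classical
  have hae : ∀ t, AEMeasurable (B t) P := hB.toIsPreBrownianReal.aemeasurable
  set D : ℕ → ℝ≥0 := TopologicalSpace.denseSeq ℝ≥0 with hD
  have hDr : DenseRange D := TopologicalSpace.denseRange_denseSeq _
  have hgood : ∀ᵐ ω ∂P, Continuous (B · ω) ∧ ∀ n, B (D n) ω = (hae (D n)).mk _ ω := by
    filter_upwards [hB.cont, ae_all_iff.2 fun n => (hae (D n)).ae_eq_mk] with ω h1 h2
    exact ⟨h1, h2⟩
  obtain ⟨S, hS1, hS2⟩ := eventually_iff_exists_mem.1 hgood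
  -- The exceptional set is enlarged to a measurable null set, so that setting the path to `0` there
  -- preserves measurability.
  obtain ⟨N, hNsub, hNm, hN0⟩ := exists_measurable_superset_of_null (mem_ae_iff.1 hS1)
  have hNc : ∀ ω ∉ N, Continuous (B · ω) ∧ ∀ n, B (D n) ω = (hae (D n)).mk _ ω := by
    intro ω hω
    refine hS2 ω ?_
    by_contra h
    exact hω (hNsub h)
  refine ⟨fun t ω => if ω ∈ N then 0 else B t ω, fun t => ?_, fun ω => ?_, ?_⟩
  · obtain ⟨u, hu, hlim⟩ := mem_closure_iff_seq_limit.1 (hDr t)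
    choose n hn using hu
    refine measurable_of_tendsto_metrizable
      (f := fun j ω => if ω ∈ N then 0 else (hae (D (n j))).mk _ ω)
      (fun j => Measurable.ite hNm measurable_const (hae _).measurable_mk) ?_
    rw [tendsto_pi_nhds]
    intro ω
    by_cases hω : ω ∈ N
    · simp [hω]
    · simp only [hω, if_false]
      obtain ⟨h1, h2⟩ := hNc ω hω
      refine ((h1.tendsto t).comp hlim).congr fun j => ?_
      rw [← h2, hn]
      rfl
  · by_cases hω : ω ∈ N
    · simp [hω, continuous_const]
    · simpa [hω] using (hNc ω hω).1
  · filter_upwards [measure_eq_zero_iff_ae_notMem.1 hN0] with ω hω t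
    simp [hω]

end

section

variable {Ω Ω' Ω₂ : Type*} [MeasurableSpace Ω] [MeasurableSpace Ω'] [MeasurableSpace Ω₂]

/-! ### Measurability of the stopping times -/

theorem sInf_image_setOf {ι α : Type*} [CompleteLattice α] (f : ι → α) (p : ι → Prop)
    [DecidablePred p] :
    sInf (f '' {i | p i}) = ⨅ i, if p i then f i else ⊤ := by
  rw [sInf_image]
  refine iInf_congr fun i => ?_
  by_cases h : p i <;> simp [h]

theorem aemeasurable_stoppingTime_div {P : Measure Ω} {Y : ℕ → Ω → ℝ}
    (hY : ∀ t, AEMeasurable (Y t) P) (K : ℝ → ℝ) (h : ℕ → ℝ) (κ c : ℝ) (T : ℕ) :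
    AEMeasurable (fun ω => stoppingTime K h Y κ c T ω / ((T : ℝ) : EReal)) P := by
  classical
  have hdiv : Measurable fun x : EReal => x / ((T : ℝ) : EReal) := by
    simp only [EReal.div_eq_inv_mul]
    exact (measurable_const.mul measurable_id)
  refine hdiv.comp_aemeasurable ?_
  have hD : ∀ t : ℕ, AEMeasurable (dfProcess K h Y T ((t : ℝ) / T)) P := by
    intro t
    unfold dfProcess
    refine AEMeasurable.div (AEMeasurable.const_mul ?_ _) (AEMeasurable.const_mul ?_ _)
    · exact Finset.aemeasurable_fun_sum _ fun i _ =>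
        ((hY _).mul ((hY _).sub (hY _))).mul_const _
    · exact Finset.aemeasurable_fun_sum _ fun i _ => (hY _).pow_const 2
  have heq : stoppingTime K h Y κ c T = fun ω => ⨅ t : ℕ,
      if ⌊(T : ℝ) * κ⌋₊ ≤ t ∧ t ≤ T ∧ dfProcess K h Y T ((t : ℝ) / T) ω < c
        then ((t : ℝ) : EReal) else ⊤ := by
    ext ω
    exact sInf_image_setOf (fun t : ℕ => ((t : ℝ) : EReal)) fun t =>
      ⌊(T : ℝ) * κ⌋₊ ≤ t ∧ t ≤ T ∧ dfProcess K h Y T ((t : ℝ) / T) ω < c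
  rw [heq]
  refine AEMeasurable.iInf fun t => ?_
  by_cases ht : ⌊(T : ℝ) * κ⌋₊ ≤ t ∧ t ≤ T
  · have hg : Measurable fun x : ℝ => if x < c then ((t : ℝ) : EReal) else ⊤ :=
      Measurable.ite measurableSet_Iio measurable_const measurable_const
    simpa [ht.1, ht.2] using! hg.comp_aemeasurable (hD t)
  · have : ∀ ω, ¬ (⌊(T : ℝ) * κ⌋₊ ≤ t ∧ t ≤ T ∧ dfProcess K h Y T ((t : ℝ) / T) ω < c) :=
      fun ω hω => ht ⟨hω.1, hω.2.1⟩
    simp only [this, if_false]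
    exact aemeasurable_const

open Classical in
-- The set where `G` is negative is relatively open in `[a, b]`, so rational times reach the same
-- infimum. This countable form yields measurability of the limit time.
theorem sInf_image_eq_iInf_rat {G : ℝ → ℝ} {a b : ℝ} (hab : a < b)
    (hG : ContinuousOn G (Icc a b)) :
    sInf ((fun s : ℝ => (s : EReal)) '' {s | s ∈ Icc a b ∧ G s < 0})
      = ⨅ q : ℚ, if (q : ℝ) ∈ Icc a b ∧ G q < 0 then ((q : ℝ) : EReal) else ⊤ := by
  refine le_antisymm (le_iInf fun q => ?_) ?_
  · split_ifs with h
    · exact sInf_le ⟨q, h, rfl⟩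
    · exact le_top
  · refine le_of_forall_gt fun x hx => ?_
    obtain ⟨_, ⟨s, ⟨hsI, hs⟩, rfl⟩, hsx⟩ := sInf_lt_iff.1 hx
    have h1 : ∀ᶠ y in 𝓝[Icc a b] s, G y < 0 ∧ (y : EReal) < x :=
      ((hG s hsI).eventually_lt_const hs).and
        (((continuous_coe_real_ereal.tendsto s).mono_left nhdsWithin_le_nhds).eventually_lt_const
          hsx)
    obtain ⟨O, hO, hsO, hOsub⟩ := mem_nhdsWithin.1 h1
    have hcl : s ∈ closure (Ioo a b) := by rwa [closure_Ioo hab.ne]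
    obtain ⟨q, hq1, hq2⟩ := Rat.denseRange_cast (𝕜 := ℝ).exists_mem_open (hO.inter isOpen_Ioo)
      (mem_closure_iff.1 hcl O hO hsO)
    have h2 := hOsub ⟨hq1, Ioo_subset_Icc_self hq2⟩
    refine lt_of_le_of_lt (iInf_le _ q) ?_
    rw [if_pos ⟨Ioo_subset_Icc_self hq2, h2.1⟩]
    exact h2.2

theorem limitTime_eq {Ω' : Type*} {K : ℝ → ℝ} (hK : ContDiff ℝ 2 K) {B : ℝ≥0 → Ω' → ℝ} {ω : Ω'}
    (hc : Continuous (B · ω)) {ζ κ c η v σ θ : ℝ} (hκ : 0 < κ) (hη : 0 < η) (hv : 0 ≤ v)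
    (hσ : σ = √v) (hθ : θ = η / σ) (hB : B κ.toNNReal ω ≠ 0) :
    limitTime K ζ θ B κ c ω = sInf ((fun s : ℝ => (s : EReal)) '' {s | s ∈ Icc κ 1 ∧
      crossing K ζ c (fun r => (η * B r.toNNReal ω) ^ 2 - v * r)
        (fun r => (η * B r.toNNReal ω) ^ 2) s < 0}) := by
  have hBc : Continuous fun r : ℝ => B r.toNNReal ω := hc.comp continuous_real_toNNReal
  have hθv : (θ ^ 2)⁻¹ = v / η ^ 2 := by
    rw [hθ, hσ, div_pow, Real.sq_sqrt hv, inv_div]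
  unfold limitTime
  congr 2
  ext s
  refine and_congr_right fun hs => ?_
  have hs0 : 0 < s := hκ.trans_le hs.1
  have hI : 0 < ∫ r in (0 : ℝ)..s, B r.toNNReal ω ^ 2 :=
    intervalIntegral.integral_pos hs0 (hBc.pow 2).continuousOn (fun _ _ => sq_nonneg _)
      ⟨κ, ⟨hκ.le, hs.1⟩, by positivity⟩
  rw [limitProcess, hθv]
  exact lt_iff_crossing_lt_zero hK (f := fun r => B r.toNNReal ω) hBc hη hs0 hI

theorem aemeasurable_limitTime {P' : Measure Ω'} {B : ℝ≥0 → Ω' → ℝ} (hB : IsBrownianReal B P')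
    {K : ℝ → ℝ} (hK : ContDiff ℝ 2 K) {ζ κ c η v σ θ : ℝ} (hκ : κ ∈ Ioo (0 : ℝ) 1) (hη : 0 < η)
    (hv : 0 ≤ v) (hσ : σ = √v) (hθ : θ = η / σ) :
    AEMeasurable (limitTime K ζ θ B κ c) P' := by
  classical
  obtain ⟨C, hCm, hCc, hBC⟩ := exists_continuous_measurable_version hB
  have hCc' : ∀ ω, Continuous fun r : ℝ => C r.toNNReal ω := fun ω =>
    (hCc ω).comp continuous_real_toNNReal
  set G : ℝ → Ω' → ℝ := fun s ω => crossing K ζ c (fun r => (η * C r.toNNReal ω) ^ 2 - v * r)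
    (fun r => (η * C r.toNNReal ω) ^ 2) s with hG
  have hGm : ∀ s, Measurable (G s) := fun s =>
    measurable_crossing hK ζ c (fun ω => by have := hCc' ω; fun_prop)
      (fun r => (((hCm _).const_mul η).pow_const 2).sub_const _)
      (fun ω => by have := hCc' ω; fun_prop) (fun r => ((hCm _).const_mul η).pow_const 2) s
  refine ⟨fun ω => ⨅ q : ℚ, if (q : ℝ) ∈ Icc κ 1 ∧ G q ω < 0 then ((q : ℝ) : EReal) else ⊤,
    Measurable.iInf fun q => Measurable.ite ?_ measurable_const measurable_const, ?_⟩
  · exact (MeasurableSet.const _).inter (measurableSet_lt (hGm q) measurable_const)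
  · filter_upwards [hB.cont, hBC, ae_ne_zero hB.toIsPreBrownianReal
      (Real.toNNReal_pos.2 hκ.1)] with ω h1 h2 h3
    rw [limitTime_eq hK h1 hκ.1 hη hv hσ hθ h3]
    simp only [h2]
    have hc := hCc' ω
    exact sInf_image_eq_iInf_rat hκ.2
      (continuousOn_crossing hK ζ c (by fun_prop) (by fun_prop) hκ.1 le_rfl)

/-! ### Moments of the errors -/

theorem StrictlyStationary.identDistrib {X : ℕ → Ω → ℝ} {P : Measure Ω}
    (h : StrictlyStationary X P) {i : ℕ} (hi : 1 ≤ i) : IdentDistrib (X 1) (X i) P P := by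
  have h1 := (h (i - 1) 1 (fun _ => 1) (fun _ => le_rfl)).comp (measurable_pi_apply 0)
  rw [Nat.add_sub_cancel' hi] at h1
  exact h1

theorem IsAR1.eq_sum {Ω : Type*} {ε Y : ℕ → Ω → ℝ} (hY : IsAR1 1 ε Y) (n : ℕ) (ω : Ω) :
    Y n ω = ∑ i ∈ Finset.Icc 1 n, ε i ω := by
  induction n with
  | zero => simp [(hY ω).1]
  | succ n ih => rw [Finset.sum_Icc_succ_top (by omega), (hY ω).2, ih, one_mul]

section Errors

variable {P : Measure Ω} [IsProbabilityMeasure P] {P' : Measure Ω'} [IsProbabilityMeasure P']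
  {P₂ : Measure Ω₂} [IsProbabilityMeasure P₂] {B : ℝ≥0 → Ω' → ℝ} {B₂ : ℝ≥0 → Ω₂ → ℝ}
  {ε Y : ℕ → Ω → ℝ} {η η' : ℝ}

theorem ErrorAssumptions.integral_sq_eq (hε : ErrorAssumptions ε P η η' B P' B₂ P₂) {i : ℕ}
    (hi : 1 ≤ i) : ∫ ω, ε i ω ^ 2 ∂P = ∫ ω, ε 1 ω ^ 2 ∂P :=
  (((hε.stationary.identDistrib hi).comp (measurable_id.pow_const 2)).integral_eq).symm

/-- With zero variance all errors, hence all partial sums, would vanish almost surely, while the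
limit `η B(1)` is almost surely nonzero. -/
theorem ErrorAssumptions.integral_sq_pos (hε : ErrorAssumptions ε P η η' B P' B₂ P₂)
    (hB : IsBrownianReal B P') : 0 < ∫ ω, ε 1 ω ^ 2 ∂P := by
  refine lt_of_le_of_ne (integral_nonneg fun _ => sq_nonneg _) fun h0 => ?_
  have hint : Integrable (fun ω => ε 1 ω ^ 2) P :=
    (hε.fourth_moment.mono_exponent (by norm_num : (2 : ℝ≥0∞) ≤ 4)).integrable_sq
  have h1 : ∀ᵐ ω ∂P, ε 1 ω ∈ ({0} : Set ℝ) := by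
    filter_upwards [(integral_eq_zero_iff_of_nonneg (fun _ => sq_nonneg _) hint).1 h0.symm]
      with ω hω
    exact pow_eq_zero_iff (two_ne_zero) |>.1 hω
  have h2 : ∀ᵐ ω ∂P, ∀ i, 1 ≤ i → ε i ω = 0 := by
    simp only [ae_all_iff]
    exact fun i hi => (hε.stationary.identDistrib hi).ae_mem_snd (measurableSet_singleton 0) h1
  have h3 := limsup_measure_le_of_tendstoInDistribution hε.fclt
    (fun T => {ω | ∀ s, (partialSumPath ε T ω).toFun s = 0}) ∅ ?_
  · have h4 : ∀ T : ℕ, P {ω | ∀ s, (partialSumPath ε T ω).toFun s = 0} = 1 := by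
      intro T
      refine (measure_congr (eventuallyEq_univ.2 ?_)).trans measure_univ
      filter_upwards [h2] with ω hω s
      simp only [partialSumPath]
      rw [Finset.sum_eq_zero fun i hi => hω i (Finset.mem_Icc.1 hi).1, mul_zero]
    simp only [h4, limsup_const, measure_empty] at h3
    exact absurd h3 (by norm_num)
  · filter_upwards [hB.cont, ae_ne_zero hB.toIsPreBrownianReal one_pos] with ω hc h1 τ w _ hw hlim
    have hu := tendstoUniformly_of_tendsto_skorokhod (continuous_scaledPath hc η) hlim
    have h4 := hu.tendsto_at 1
    rw [scaledPath_toFun hc, unitInterval.toNNReal_one] at h4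
    have h5 : Tendsto (fun j => (partialSumPath ε (τ j) (w j)).toFun 1) atTop (𝓝 0) := by
      simp [fun j => hw j 1]
    exact absurd (tendsto_nhds_unique h4 h5) (mul_ne_zero hε.η_pos.ne' h1)

/-! ### Uniform convergence of the rescaled paths -/

theorem tendstoUniformlyOn_sq_div {Ω Ω' : Type*} {B : ℝ≥0 → Ω' → ℝ} {ε Y : ℕ → Ω → ℝ} {η : ℝ}
    (hY : IsAR1 1 ε Y) {τ : ℕ → ℕ} (w : ℕ → Ω) {ω : Ω'}
    (hc : Continuous (B · ω)) (hlim : Tendsto (fun j => partialSumPath ε (τ j) (w j)) atTop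
      (𝓝 (scaledPath η B ω))) :
    TendstoUniformlyOn (fun j r => Y ⌊(τ j : ℝ) * r⌋₊ (w j) ^ 2 / τ j)
      (fun r => (η * B r.toNNReal ω) ^ 2) atTop (Icc 0 1) := by
  have hcs := continuous_scaledPath hc η
  have hu := tendstoUniformly_of_tendsto_skorokhod hcs hlim
  obtain ⟨M, hM⟩ := (isCompact_range hcs).isBounded.exists_norm_le
  have hM0 : 0 ≤ M := (norm_nonneg _).trans (hM _ (mem_range_self 0))
  rw [Metric.tendstoUniformlyOn_iff]
  intro e he
  -- For paths within distance `1` and a limit bounded by `M`, the difference of squares is at most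
  -- `2 M + 1` times the difference.
  have hd : 0 < min 1 (e / (2 * M + 2)) := lt_min one_pos (by positivity)
  filter_upwards [Metric.tendstoUniformly_iff.1 hu _ hd] with j hj r hr
  have h1 := hj ⟨r, hr⟩
  have h2 := hM _ (mem_range_self (⟨r, hr⟩ : unitInterval))
  have hr' : unitInterval.toNNReal ⟨r, hr⟩ = r.toNNReal := by
    ext
    simp [Real.coe_toNNReal _ hr.1]
  rw [scaledPath_toFun hc, hr'] at h1 h2
  have h3 : Y ⌊(τ j : ℝ) * r⌋₊ (w j) ^ 2 / τ j
      = ((partialSumPath ε (τ j) (w j)).toFun ⟨r, hr⟩) ^ 2 := by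
    simp only [partialSumPath]
    rw [hY.eq_sum, mul_pow, inv_pow, Real.sq_sqrt (Nat.cast_nonneg _)]
    ring
  rw [h3]
  generalize (partialSumPath ε (τ j) (w j)).toFun ⟨r, hr⟩ = x at h1
  generalize η * B r.toNNReal ω = y at h1 h2
  rw [Real.dist_eq] at h1 ⊢
  rw [Real.norm_eq_abs] at h2
  have h4 : |y + x| ≤ 2 * M + 1 := by
    have e1 : y + x = 2 * y - (y - x) := by ring
    rw [e1]
    refine (abs_sub _ _).trans ?_
    rw [abs_mul, abs_two]
    have := h1.trans_le (min_le_left _ _)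
    linarith
  have h5 : y ^ 2 - x ^ 2 = (y - x) * (y + x) := by ring
  rw [h5, abs_mul]
  have h6 := h1.trans_le (min_le_right _ _)
  rw [lt_div_iff₀ (by positivity)] at h6
  nlinarith [abs_nonneg (y - x), abs_nonneg (y + x)]

/-- The bound on the centred sums leaves an error `T^{-1/4}`, and replacing `⌊T r⌋` by `T r` costs
at most `v / T`. No limit of the second process is needed. -/
theorem tendstoUniformlyOn_sum_sq_div (hε : ErrorAssumptions ε P η η' B P' B₂ P₂) {τ : ℕ → ℕ}
    (hτ : Tendsto τ atTop atTop) (w : ℕ → Ω)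
    (hw : ∀ j s, |(partialSumPath (fun i ω => ε i ω ^ 2 - ∫ ω', ε i ω' ^ 2 ∂P) (τ j)
      (w j)).toFun s| < √(√(τ j : ℝ))) :
    TendstoUniformlyOn (fun j r => (∑ i ∈ Finset.Icc 1 ⌊(τ j : ℝ) * r⌋₊, ε i (w j) ^ 2) / τ j)
      (fun r => (∫ ω, ε 1 ω ^ 2 ∂P) * r) atTop (Icc 0 1) := by
  set v := ∫ ω, ε 1 ω ^ 2 ∂P with hv
  have hv0 : 0 ≤ v := integral_nonneg fun _ => sq_nonneg _
  have hτ' : Tendsto (fun j => (τ j : ℝ)) atTop atTop := tendsto_natCast_atTop_atTop.comp hτ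
  have hb : Tendsto (fun j => (√(√(τ j : ℝ)))⁻¹ + v / (τ j : ℝ)) atTop (𝓝 0) := by
    have h1 := (Real.tendsto_sqrt_atTop.comp (Real.tendsto_sqrt_atTop.comp hτ')).inv_tendsto_atTop
    have h2 := hτ'.const_div_atTop v
    simpa using! h1.add h2
  rw [Metric.tendstoUniformlyOn_iff]
  intro e he
  filter_upwards [hb.eventually_lt_const he, hτ.eventually_gt_atTop 0] with j h1 h2 r hr
  have hT : (0 : ℝ) < τ j := by exact_mod_cast h2
  have h3 := hw j ⟨r, hr⟩
  simp only [partialSumPath] at h3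
  set n := ⌊(τ j : ℝ) * r⌋₊ with hn
  have h4 : ∑ i ∈ Finset.Icc 1 n, (ε i (w j) ^ 2 - ∫ ω', ε i ω' ^ 2 ∂P)
      = ∑ i ∈ Finset.Icc 1 n, ε i (w j) ^ 2 - n * v := by
    rw [Finset.sum_sub_distrib, Finset.sum_congr rfl fun i hi =>
      hε.integral_sq_eq (Finset.mem_Icc.1 hi).1]
    simp [hv]
  rw [h4] at h3
  generalize ∑ i ∈ Finset.Icc 1 n, ε i (w j) ^ 2 = S at h3 ⊢
  have hs : √(τ j : ℝ) * √(τ j : ℝ) = τ j := Real.mul_self_sqrt hT.le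
  have hs0 : 0 < √(τ j : ℝ) := Real.sqrt_pos.2 hT
  have hs1 : 0 < √(√(τ j : ℝ)) := Real.sqrt_pos.2 hs0
  have hss : √(√(τ j : ℝ)) * √(√(τ j : ℝ)) = √(τ j : ℝ) := Real.mul_self_sqrt hs0.le
  have h5 : |S - n * v| / τ j < (√(√(τ j : ℝ)))⁻¹ := by
    rw [abs_mul, abs_of_pos (inv_pos.2 hs0), inv_mul_lt_iff₀ hs0] at h3
    rw [div_lt_iff₀ hT, ← div_eq_inv_mul, lt_div_iff₀ hs1]
    calc |S - n * v| * √(√(τ j : ℝ)) < √(τ j : ℝ) * √(√(τ j : ℝ)) * √(√(τ j : ℝ)) := by gcongr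
      _ = τ j := by rw [mul_assoc, hss, hs]
  have h6 : |n * v / τ j - v * r| ≤ v / τ j := by
    have e1 : n * v / τ j - v * r = (v / τ j) * (n - τ j * r) := by field_simp
    have e2 : |(n : ℝ) - τ j * r| ≤ 1 := by
      rw [abs_sub_comm, abs_of_nonneg (sub_nonneg.2 (Nat.floor_le (by have := hr.1; positivity)))]
      linarith [Nat.lt_floor_add_one ((τ j : ℝ) * r)]
    rw [e1, abs_mul, abs_of_nonneg (by positivity)]
    exact mul_le_of_le_one_right (by positivity) e2
  rw [dist_comm, Real.dist_eq]
  have e3 : S / τ j - v * r = (S - n * v) / τ j + (n * v / τ j - v * r) := by ring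
  rw [e3]
  refine (abs_add_le _ _).trans_lt ?_
  rw [abs_div, abs_of_pos hT]
  linarith

end Errors

end

section

/-! ### Convergence of the stopping time -/

theorem setOf_dfProcess_lt_eq {Ω : Type*} {K : ℝ → ℝ} (hK : ContDiff ℝ 2 K) {ε Y : ℕ → Ω → ℝ}
    (hY : IsAR1 1 ε Y) (h : ℕ → ℝ) {T : ℕ} (hT : 0 < T) {κ c : ℝ} (hκ : 1 ≤ (T : ℝ) * κ)
    (hc : c < 0) (ω : Ω) :
    {t : ℕ | ⌊(T : ℝ) * κ⌋₊ ≤ t ∧ t ≤ T ∧ dfProcess K h Y T ((t : ℝ) / T) ω < c}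
      = {t : ℕ | ⌊(T : ℝ) * κ⌋₊ ≤ t ∧ t ≤ T ∧ crossing K (T / h T) c
        (fun r => Y ⌊(T : ℝ) * r⌋₊ ω ^ 2 / T -
          (∑ i ∈ Finset.Icc 1 ⌊(T : ℝ) * r⌋₊, ε i ω ^ 2) / T)
        (fun r => Y ⌊(T : ℝ) * r⌋₊ ω ^ 2 / T) ((t : ℝ) / T) < 0} := by
  have hT' : (T : ℝ) ≠ 0 := by exact_mod_cast hT.ne'
  ext t
  refine and_congr_right fun ht => and_congr_right fun _ => ?_
  -- The assumption `1 ≤ T κ` excludes `t = 0`, where the normalisations by `t` would degenerate.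
  have ht0 : 0 < t := lt_of_lt_of_le (Nat.floor_pos.2 hκ) ht
  have hsq : ∀ n, (∑ i ∈ Finset.Icc 1 n, (Y i ω - Y (i - 1) ω) ^ 2)
      = ∑ i ∈ Finset.Icc 1 n, ε i ω ^ 2 := by
    intro n
    refine Finset.sum_congr rfl fun i hi => ?_
    obtain ⟨m, rfl⟩ : ∃ m, i = m + 1 := ⟨i - 1, by have := (Finset.mem_Icc.1 hi).1; omega⟩
    rw [Nat.add_sub_cancel, (hY ω).2 m]
    ring
  have h1 := div_lt_iff_crossing hK (fun n => Y n ω) (hY ω).1 (h T) hT ht0 hc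
  simp only [compensatedSq, hsq, sub_div _ _ (T : ℝ)] at h1
  rw [dfProcess, mul_div_cancel₀ _ hT', Nat.floor_natCast]
  exact h1

theorem measurable_comp_natFloor (a : ℕ → ℝ) (T : ℝ) : Measurable fun r : ℝ => a ⌊T * r⌋₊ :=
  measurable_from_nat.comp (Nat.measurable_floor.comp (measurable_id.const_mul T))

theorem _root_.TendstoUniformlyOn.comp_fst {α : Type*} {U : ℕ → ℝ → ℝ} {U₀ : ℝ → ℝ} {S : Set ℝ}
    (hU : TendstoUniformlyOn U U₀ atTop S) (l : Filter α) :
    TendstoUniformlyOn (fun p : ℕ × α => U p.1) U₀ (atTop ×ˢ l) S :=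
  fun u hu => tendsto_fst.eventually (hU u hu)

variable {Ω Ω' Ω₂ : Type*} [MeasurableSpace Ω] [MeasurableSpace Ω'] [MeasurableSpace Ω₂]
  {P : Measure Ω} [IsProbabilityMeasure P] {P' : Measure Ω'} [IsProbabilityMeasure P']
  {P₂ : Measure Ω₂} [IsProbabilityMeasure P₂] {B : ℝ≥0 → Ω' → ℝ} {B₂ : ℝ≥0 → Ω₂ → ℝ}
  {ε Y : ℕ → Ω → ℝ} {η η' : ℝ}

/-- The pathwise continuous mapping step: the sample points `w j` may vary with `j`, and all
randomness has been reduced to the conditions on `ω` and on the paths. -/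
theorem tendsto_stoppingTime_div (hε : ErrorAssumptions ε P η η' B P' B₂ P₂) (hY : IsAR1 1 ε Y)
    {K : ℝ → ℝ} (hK : ContDiff ℝ 2 K) {h : ℕ → ℝ} {ζ κ c v : ℝ}
    (hh : Tendsto (fun T : ℕ => (T : ℝ) / h T) atTop (𝓝 ζ)) (hκ : κ ∈ Ioo (0 : ℝ) 1) (hc : c < 0)
    (hv : v = ∫ ω, ε 1 ω ^ 2 ∂P) {ω : Ω'} (hcont : Continuous (B · ω))
    (hreg : ∀ x ∈ Icc κ 1, (x = 1 ∨ ∃ q : ℚ, x = q) →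
      (∀ s ∈ Icc κ x, 0 ≤ crossing K ζ c (fun r => (η * B r.toNNReal ω) ^ 2 - v * r)
        (fun r => (η * B r.toNNReal ω) ^ 2) s) →
      ∀ s ∈ Icc κ x, 0 < crossing K ζ c (fun r => (η * B r.toNNReal ω) ^ 2 - v * r)
        (fun r => (η * B r.toNNReal ω) ^ 2) s)
    {τ : ℕ → ℕ} (hτ : Tendsto τ atTop atTop) (w : ℕ → Ω)
    (hw : ∀ j s, |(partialSumPath (fun i ω => ε i ω ^ 2 - ∫ ω', ε i ω' ^ 2 ∂P) (τ j)
      (w j)).toFun s| < √(√(τ j : ℝ)))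
    (hlim : Tendsto (fun j => partialSumPath ε (τ j) (w j)) atTop (𝓝 (scaledPath η B ω))) :
    Tendsto (fun j => stoppingTime K h Y κ c (τ j) (w j) / ((τ j : ℝ) : EReal)) atTop
      (𝓝 (sInf ((fun s : ℝ => (s : EReal)) '' {s | s ∈ Icc κ 1 ∧
        crossing K ζ c (fun r => (η * B r.toNNReal ω) ^ 2 - v * r)
        (fun r => (η * B r.toNNReal ω) ^ 2) s < 0}))) := by
  have hBc : Continuous fun r : ℝ => B r.toNNReal ω := hcont.comp continuous_real_toNNReal
  have hV := tendstoUniformlyOn_sq_div hY w hcont hlim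
  have hW := tendstoUniformlyOn_sum_sq_div hε hτ w hw
  rw [← hv] at hW
  have hU := hV.sub hW
  have hVm : ∀ j, Measurable fun r : ℝ => Y ⌊(τ j : ℝ) * r⌋₊ (w j) ^ 2 / τ j := fun j =>
    measurable_comp_natFloor (fun n => Y n (w j) ^ 2 / τ j) _
  have hWm : ∀ j, Measurable fun r : ℝ =>
      (∑ i ∈ Finset.Icc 1 ⌊(τ j : ℝ) * r⌋₊, ε i (w j) ^ 2) / τ j := fun j =>
    measurable_comp_natFloor (fun n => (∑ i ∈ Finset.Icc 1 n, ε i (w j) ^ 2) / τ j) _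
  refine tendsto_hittingTime (E := fun j => {t : ℕ | ⌊(τ j : ℝ) * κ⌋₊ ≤ t ∧ t ≤ τ j ∧
      dfProcess K h Y (τ j) ((t : ℝ) / τ j) (w j) < c})
    (G := fun j => crossing K (τ j / h (τ j)) c
      (fun r => Y ⌊(τ j : ℝ) * r⌋₊ (w j) ^ 2 / τ j -
          (∑ i ∈ Finset.Icc 1 ⌊(τ j : ℝ) * r⌋₊, ε i (w j) ^ 2) / τ j)
      (fun r => Y ⌊(τ j : ℝ) * r⌋₊ (w j) ^ 2 / τ j)) hκ hτ ?_ hreg ?_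
  · intro s hs
    refine tendsto_crossing hK c (ι := ℕ × ℝ) (s := fun p => p.2)
      (z := fun p => (τ p.1 : ℝ) / h (τ p.1)) (hU.comp_fst _) (fun p => (hVm p.1).sub (hWm p.1))
      (Continuous.continuousOn (by fun_prop)) (hV.comp_fst _) (fun p => hVm p.1)
      (Continuous.continuousOn (by fun_prop)) ((hh.comp hτ).comp tendsto_fst)
      (tendsto_snd.mono_right nhdsWithin_le_nhds)
      (tendsto_snd.eventually self_mem_nhdsWithin) ⟨hκ.1.trans_le hs.1, hs.2⟩
  · have h1 : Tendsto (fun j => (τ j : ℝ) * κ) atTop atTop :=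
      (tendsto_natCast_atTop_atTop.comp hτ).atTop_mul_const hκ.1
    filter_upwards [hτ.eventually_gt_atTop 0, h1.eventually_ge_atTop 1] with j h2 h3
    exact setOf_dfProcess_lt_eq hK hY h h2 h3 hc (w j)

end

end DickeyFuller

end

/-! ### Assembly of the main theorem -/

theorem mainTheorem2
    {Ω Ω' Ω₂ : Type*} [MeasurableSpace Ω] [MeasurableSpace Ω'] [MeasurableSpace Ω₂]
    (P : Measure Ω) [IsProbabilityMeasure P]
    (P' : Measure Ω') [IsProbabilityMeasure P']
    (P₂ : Measure Ω₂) [IsProbabilityMeasure P₂]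
    (B : ℝ≥0 → Ω' → ℝ) (hB : IsBrownianReal B P')
    (B₂ : ℝ≥0 → Ω₂ → ℝ) (hB₂ : IsBrownianReal B₂ P₂)
    (ε Y : ℕ → Ω → ℝ) (η η' : ℝ)
    (hε : DickeyFuller.ErrorAssumptions ε P η η' B P' B₂ P₂)
    (hY : DickeyFuller.IsAR1 1 ε Y)
    (K : ℝ → ℝ) (hK : DickeyFuller.KernelAssumptions K)
    (h : ℕ → ℝ) (ζ : ℝ) (hζ : 1 ≤ ζ)
    (hh : Tendsto (fun T : ℕ => (T : ℝ) / h T) atTop (𝓝 ζ))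
    (κ : ℝ) (hκ : κ ∈ Ioo (0 : ℝ) 1)
    (σ : ℝ) (hσ : σ = √(∫ ω, ε 1 ω ^ 2 ∂P))
    (θ : ℝ) (hθ : θ = η / σ)
    (c : ℝ) (hc : c < 0) :
    TendstoInDistribution
      (fun (T : ℕ) (ω : Ω) => DickeyFuller.stoppingTime K h Y κ c T ω / ((T : ℝ) : EReal))
      atTop
      (DickeyFuller.limitTime K ζ θ B κ c)
      (fun _ => P) P' := by
  open DickeyFuller in
  have hKd := hK.contDiff
  have hv0 := hε.integral_sq_pos hB
  have hεm : ∀ i, 1 ≤ i → AEMeasurable (ε i) P := fun i hi =>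
    (hε.stationary.identDistrib hi).aemeasurable_snd
  have hYm : ∀ t, AEMeasurable (Y t) P := by
    intro t
    rw [show Y t = fun ω => ∑ i ∈ Finset.Icc 1 t, ε i ω from funext (hY.eq_sum t)]
    exact Finset.aemeasurable_fun_sum _ fun i hi => hεm i (Finset.mem_Icc.1 hi).1
  have hSm := aemeasurable_stoppingTime_div hYm K h κ c
  have hLm : AEMeasurable (limitTime K ζ θ B κ c) P' :=
    aemeasurable_limitTime hB hKd hκ hε.η_pos hv0.le hσ hθ
  refine ⟨hSm, hLm, tendsto_of_forall_isClosed_limsup_le' fun F hF => ?_⟩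
  simp only [ProbabilityMeasure.coe_mk]
  rw [Measure.map_apply_of_aemeasurable hLm hF.measurableSet]
  simp only [Measure.map_apply_of_aemeasurable (hSm _) hF.measurableSet]
  set path₂ := partialSumPath (fun i ω => ε i ω ^ 2 - ∫ ω', ε i ω' ^ 2 ∂P) with hpath₂
  have hsmall : Tendsto (fun T : ℕ => P {ω | ∃ s, √(√(T : ℝ)) ≤ |(path₂ T ω).toFun s|}) atTop
      (𝓝 0) :=
    tendsto_measure_exists_le_abs hε.fclt_sq
      (hB₂.cont.mono fun ω hω => continuous_scaledPath hω η')
      (Real.tendsto_sqrt_atTop.comp (Real.tendsto_sqrt_atTop.comp tendsto_natCast_atTop_atTop))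
  -- Restricting to small centred square sums replaces joint convergence of the two processes; the
  -- discarded events have probability tending to `0`.
  set A : ℕ → Set Ω := fun T => {ω | stoppingTime K h Y κ c T ω / ((T : ℝ) : EReal) ∈ F ∧
    ∀ s, |(path₂ T ω).toFun s| < √(√(T : ℝ))} with hA
  have hle : limsup (fun T => P (A T)) atTop ≤ P' (limitTime K ζ θ B κ c ⁻¹' F) := by
    refine limsup_measure_le_of_tendstoInDistribution hε.fclt A _ ?_
    -- The no-touching argument needs continuity of every path and genuine measurability, so it is
    -- run for `C` and transferred to `B`.
    obtain ⟨C, hCm, hCc, hBC⟩ := exists_continuous_measurable_version hB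
    have hC : IsPreBrownianReal C P' := hB.toIsPreBrownianReal.congr fun t => by
      filter_upwards [hBC] with ω hω using hω t
    have hpos : ∀ x, κ ≤ x → x ≤ 1 → _ := fun x hκx hx => ae_crossing_pos hC hCm hCc hKd hK.nonneg ζ
      hc hv0 hε.η_pos hκ.1 hκx hx
    have hposq := ae_all_iff.2 fun q : ℚ => ae_all_iff.2 fun hκq : κ ≤ q =>
      ae_all_iff.2 fun hq : (q : ℝ) ≤ 1 => hpos q hκq hq
    filter_upwards [hB.cont, hBC, hpos 1 hκ.2.le le_rfl, hposq,
      ae_ne_zero hB.toIsPreBrownianReal (Real.toNNReal_pos.2 hκ.1)] with ω h1 h2 h3 h4 h5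
      τ w hτ hw hlim
    rw [mem_preimage, limitTime_eq hKd h1 hκ.1 hε.η_pos hv0.le hσ hθ h5]
    refine hF.mem_of_tendsto (tendsto_stoppingTime_div hε hY hKd hh hκ hc rfl h1 ?_ hτ w
      (fun j => (hw j).2) hlim) (Eventually.of_forall fun j => (hw j).1)
    simp only [h2]
    rintro x hx (rfl | ⟨q, rfl⟩)
    · exact h3
    · exact h4 q hx.1 hx.2
  calc limsup (fun T : ℕ => P ((fun ω => stoppingTime K h Y κ c T ω / ((T : ℝ) : EReal)) ⁻¹' F))
        atTop
      ≤ limsup (fun T : ℕ => P (A T) + P {ω | ∃ s, √(√(T : ℝ)) ≤ |(path₂ T ω).toFun s|}) atTop := by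
        refine limsup_le_limsup (Eventually.of_forall fun T => ?_)
        refine (measure_mono fun ω hω => ?_).trans (measure_union_le _ _)
        by_cases hs : ∃ s, √(√(T : ℝ)) ≤ |(path₂ T ω).toFun s|
        · exact Or.inr hs
        · exact Or.inl ⟨hω, fun s => not_le.1 fun h => hs ⟨s, h⟩⟩
    _ = limsup (fun T => P (A T)) atTop := ENNReal.limsup_add_of_right_tendsto_zero hsmall _
    _ ≤ P' (limitTime K ζ θ B κ c ⁻¹' F) := hle
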